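/- Let $n\ge 0$ and let $D,D'\subset\mathbb C^{n+1}$ be domains, $p\in\partial D$, $p'\in\partial D'$. Assume that $\partial D$ and $\partial D'$ are smooth and strongly pseudoconvex near $p$ and $p'$, so that there are local holomorphic coordinates $(z,w)\in\mathbb C^n\times\mathbb C$ at $p$ and $(z',w')\in\mathbb C^n\times\mathbb C$ at $p'$, vanishing at $p$ and $p'$ respectively, in which $D$ and $D'$ are given near these points by $$\operatorname{Im} w>\|z\|^2+O(3),\qquad \operatorname{Im} w'>\|z'\|^2+O(3), \qquad (*)$$ where $\|z\|^2=|z_1|^2+\dots+|z_n|^2$ and $O(3)$ stands for a real $C^\infty$ function near the origin that is $O(\|(z,w)\|^3)$, respectively $O(\|(z',w')\|^3)$. A sequence $Z_k\in D$ converges to $p$ non-tangentially if $Z_k\to p$ and $\|Z_k-p\|\le c\,\operatorname{dist}(Z_k,\partial D)$ for all $k$ and some constant $c$. Let $\mathcal J^0_{p,p'}(D,D')$ be the set of germs at $p$ represented by holomorphic maps $F\colon U\cap D\to D'$, with $U$ an open neighborhood of $p$, such that $F(Z_k)\to p'$ whenever $Z_k\to p$ non-tangentially in $U\cap D$. A linear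 map $L\colon\mathbb C^{n+1}\to\mathbb C^{n+1}$ (a priori only real-linear) is the non-tangential differential of $F$ at $p$ if $F(Z_k)=p'+L(Z_k-p)+o(\|Z_k-p\|)$ for every sequence $(Z_k)$ in $D$ that converges to $p$ non-tangentially. 1. For all coordinates as in $(*)$, a linear map $L$ is the non-tangential differential of some germ $F\in\mathcal J^0_{p,p'}(D,D')$ if and only if, in these coordinates (that is, after composing with the differentials of the coordinate systems at $p$ and $p'$), it has the form $$\begin{pmatrix} C & A\\ 0&\lambda\end{pmatrix},$$ where $\lambda>0$ is a real number, $A\in\mathbb C^n$, and $C$ is a complex $n\times n$ matrix whose singular values $\mu_1\ge\dots\ge\mu_n\ge0$ satisfy $\mu_j\le\sqrt\lambda$ for $j=1,\dots,n$. 2. For the non-tangential differential $L$ of a germ in $\mathcal J^0_{p,p'}(D,D')$, the ratios $\mu_j/\sqrt\lambda$, $j=1,\dots,n$, do not depend on the choice of the coordinates $(z,w)$ and $(z',w')$ satisfying $(*)$. -/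

import Mathlib

open scoped ContDiff Topology
open Filter

/-- The ambient space `ℂ^(n+1)` with its Euclidean norm. -/
abbrev AmbientSpace (n : ℕ) : Type := EuclideanSpace ℂ (Fin (n + 1))

/-- The space `ℂⁿ × ℂ` in which local coordinates `(z, w)` take their values; the factor `ℂⁿ`
carries the Euclidean norm. -/
abbrev CoordSpace (n : ℕ) : Type := EuclideanSpace ℂ (Fin n) × ℂ

/-- `Z` is a sequence of points of `D` converging to `p` non-tangentially: the distance from `Z k`
to `p` does not exceed a constant multiple of the distance from `Z k` to `∂D`. -/
def NontangentialSeq {n : ℕ} (D : Set (AmbientSpace n)) (p : AmbientSpace n)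
    (Z : ℕ → AmbientSpace n) : Prop :=
  (∀ k, Z k ∈ D) ∧ Tendsto Z atTop (𝓝 p) ∧
    ∃ c : ℝ, ∀ k, dist (Z k) p ≤ c * Metric.infDist (Z k) (frontier D)

/-- `F` represents a germ at `p` of holomorphic maps from `D` to `D'` sending `p` to `p'` in the
non-tangential sense: for some open neighborhood `U` of `p`, the map `F` is holomorphic on `U ∩ D`,
maps `U ∩ D` into `D'`, and `F (Z k) → p'` whenever `Z k → p` non-tangentially in `U ∩ D`.
The values of `F` outside `U ∩ D` play no role. -/
def RepresentsGerm {n : ℕ} (D D' : Set (AmbientSpace n)) (p p' : AmbientSpace n)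
    (F : AmbientSpace n → AmbientSpace n) : Prop :=
  ∃ U : Set (AmbientSpace n), IsOpen U ∧ p ∈ U ∧
    DifferentiableOn ℂ F (U ∩ D) ∧ Set.MapsTo F (U ∩ D) D' ∧
    ∀ Z : ℕ → AmbientSpace n, NontangentialSeq D p Z → (∀ k, Z k ∈ U) →
      Tendsto (fun k => F (Z k)) atTop (𝓝 p')

/-- The linear map `L` is the non-tangential differential at `p` of the map `F` with non-tangential
value `p'`: `F (Z k) = p' + L (Z k - p) + o(‖Z k - p‖)` along every sequence of points of `D` that
converges to `p` non-tangentially. Only the restriction of `F` to points of `D` near `p` matters. -/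
def IsNontangentialDifferential {n : ℕ} (D : Set (AmbientSpace n)) (p p' : AmbientSpace n)
    (F : AmbientSpace n → AmbientSpace n) (L : AmbientSpace n →ₗ[ℝ] AmbientSpace n) : Prop :=
  ∀ Z : ℕ → AmbientSpace n, NontangentialSeq D p Z →
    (fun k => F (Z k) - p' - L (Z k - p)) =o[atTop] (fun k => Z k - p)

/-- The linear map `L` is the non-tangential differential of some germ at `p` of holomorphic maps
from `D` to `D'` sending `p` to `p'` in the non-tangential sense. -/
def IsGermDifferential {n : ℕ} (D D' : Set (AmbientSpace n)) (p p' : AmbientSpace n)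
    (L : AmbientSpace n →ₗ[ℝ] AmbientSpace n) : Prop :=
  ∃ F : AmbientSpace n → AmbientSpace n,
    RepresentsGerm D D' p p' F ∧ IsNontangentialDifferential D p p' F L

/-- `φ = (z, w)` is a system of local holomorphic coordinates at `p`, vanishing at `p`, in which
`D` is given near `p` by `Im w > ‖z‖² + r(z, w)`, where `r` is a real `C^∞` function near the origin
that vanishes there to order three. -/
structure IsNormalCoord {n : ℕ} (D : Set (AmbientSpace n)) (p : AmbientSpace n)
    (φ : OpenPartialHomeomorph (AmbientSpace n) (CoordSpace n)) : Prop where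
  mem_source : p ∈ φ.source
  map_base : φ p = 0
  holomorphic : DifferentiableOn ℂ φ φ.source
  holomorphic_symm : DifferentiableOn ℂ φ.symm φ.target
  normal_form : ∃ (r : CoordSpace n → ℝ) (W : Set (CoordSpace n)),
    IsOpen W ∧ 0 ∈ W ∧ ContDiffOn ℝ ∞ r W ∧
    r =O[𝓝 0] (fun Z => ‖Z‖ ^ 3) ∧
    ∀ᶠ Z in 𝓝 p, (Z ∈ D ↔ ‖(φ Z).1‖ ^ 2 + r (φ Z) < (φ Z).2.im)

/-- In the coordinates `φ` at `p` and `φ'` at `p'`, the linear map `L` has the matrix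
`[[C, A], [0, lam]]`, that is, `dφ'_{p'} ∘ L ∘ (dφ_p)⁻¹` is `(z, w) ↦ (C z + w A, lam w)`. -/
def HasBlockForm {n : ℕ} (φ φ' : OpenPartialHomeomorph (AmbientSpace n) (CoordSpace n))
    (p p' : AmbientSpace n) (L : AmbientSpace n →ₗ[ℝ] AmbientSpace n)
    (C : Matrix (Fin n) (Fin n) ℂ) (A : EuclideanSpace ℂ (Fin n)) (lam : ℝ) : Prop :=
  ∀ v : AmbientSpace n,
    fderiv ℂ φ' p' (L v) =
      (Matrix.toEuclideanLin C (fderiv ℂ φ p v).1 + (fderiv ℂ φ p v).2 • A,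
        (lam : ℂ) * (fderiv ℂ φ p v).2)

/-- The `j`-th singular value of the `n × n` matrix `C`, in decreasing order with multiplicity. -/
noncomputable def matrixSingularValue {n : ℕ} (C : Matrix (Fin n) (Fin n) ℂ) (j : Fin n) : ℝ :=
  (Matrix.toEuclideanLin C).singularValues j

/-! In normal coordinates both domains agree with the Siegel domain Im w > ‖z‖² up to third order,
and the statement is a boundary Schwarz lemma together with its sharpness.

Necessity. Write G for the map in coordinates and M for its differential. The rescalings t⁻¹ G(tτξ)
converge uniformly in τ near 1 to M(τξ), which is therefore holomorphic in τ; hence M is complex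
linear. Rescaling also shows that M sends Im w > 0 into Im w' ≥ 0, so its last component is λw with
λ ≥ 0. The bound on C uses the discs ζ ↦ (√t k ζ v, i t), which leave every cone as t → 0: the
differential controls G only near their centres. The centre derivative comes from a Cauchy estimate
(`CoordGerm.tendsto_deriv`), and `disc_localization` keeps the images of smaller discs near p'.
There the imaginary part of the peak function w' + i w'² dominates a‖z'‖² for any given a < 1, so
the Schwarz lemma `sq_norm_deriv_le_im` applies. Letting t → 0 and then k → 1 gives ‖Cv‖² ≤ λ for
‖v‖ ≤ 1. The quantitative form of the localization also gives λ > 0, a Hopf lemma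
(`CoordGerm.normal_ne_zero`).

Sufficiency. When some μ_j equals √λ the linear map leaves no room for the third-order errors.
`modelMap` creates room by factors that are invisible to first order: with |w| as the unit,
shrinking z gains |w|^(9/8) where Im w is comparable to |w|, and the term (-iw)^(5/4) gains
|w|^(5/4) elsewhere. The errors are only O(|w|^(3/2)), since ‖z‖² = O(|w|) on D (`modelMap_mem`).

Invariance. Necessity applied to the identity in two coordinate systems, in both directions, shows
that a coordinate change acts on z as r times a unitary map and on w as r². The singular values of C
and √λ then scale alike. -/

/-! ### Circle averages and a Schwarz lemma for discs in the Siegel domain -/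

/-- The norm of a circle average is at most the circle average of the norm. -/
theorem norm_circleAverage_le {E : Type*} [NormedAddCommGroup E] [NormedSpace ℝ E]
    (f : ℂ → E) (c : ℂ) (R : ℝ) :
    ‖Real.circleAverage f c R‖ ≤ Real.circleAverage (fun z => ‖f z‖) c R := by
  rw [Real.circleAverage_def, Real.circleAverage_def, norm_smul, smul_eq_mul, Real.norm_eq_abs,
    abs_of_pos (by positivity)]
  gcongr
  exact intervalIntegral.norm_integral_le_integral_norm Real.two_pi_pos.le

/-- The derivative at the centre of a disc as an average over the boundary circle. -/
theorem circleAverage_inv_smul_eq_deriv {E : Type*} [NormedAddCommGroup E] [NormedSpace ℂ E]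
    [CompleteSpace E] {Z : ℂ → E} {R R₁ : ℝ} (hR : 0 < R) (hRR : R < R₁)
    (hZ : DifferentiableOn ℂ Z (Metric.ball 0 R₁)) :
    Real.circleAverage (fun z => z⁻¹ • Z z) 0 R = deriv Z 0 := by
  rw [Real.circleAverage_eq_circleIntegral hR.ne',
    ← Complex.two_pi_I_inv_smul_circleIntegral_sub_sq_inv_smul_of_differentiable
      Metric.isOpen_ball (Metric.closedBall_subset_ball hRR) hZ (Metric.mem_ball_self hR)]
  simp [smul_smul, pow_two]

/-- A Schwarz lemma for holomorphic discs `(Z, W)` in the Siegel domain `a ‖Z‖² ≤ Im W`. -/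
theorem sq_norm_deriv_le_im {E : Type*} [NormedAddCommGroup E] [NormedSpace ℂ E]
    [CompleteSpace E] {Z : ℂ → E} {W : ℂ → ℂ} {a R R₁ : ℝ} (ha : 0 < a) (hR : 0 < R) (hRR : R < R₁)
    (hZ : DifferentiableOn ℂ Z (Metric.ball 0 R₁)) (hW : DifferentiableOn ℂ W (Metric.ball 0 R₁))
    (h : ∀ z ∈ Metric.ball (0 : ℂ) R₁, a * ‖Z z‖ ^ 2 ≤ (W z).im) :
    a * R ^ 2 * ‖deriv Z 0‖ ^ 2 ≤ (W 0).im := by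
  have hsub : Metric.closedBall (0 : ℂ) |R| ⊆ Metric.ball 0 R₁ := by
    rw [abs_of_pos hR]; exact Metric.closedBall_subset_ball hRR
  have hWc : ContinuousOn W (Metric.sphere 0 |R|) :=
    hW.continuousOn.mono (Metric.sphere_subset_closedBall.trans hsub)
  have hZc : ContinuousOn Z (Metric.sphere 0 |R|) :=
    hZ.continuousOn.mono (Metric.sphere_subset_closedBall.trans hsub)
  have hsph : ∀ z ∈ Metric.sphere (0 : ℂ) |R|, ‖z‖ = R := fun z hz => by
    simpa [abs_of_pos hR] using hz
  have hmeanW : Real.circleAverage (fun z => (W z).im) 0 R = (W 0).im := by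
    have h1 := circleAverage_of_differentiable_on_off_countable (c := 0) (R := R) (f := W)
      Set.countable_empty (hW.continuousOn.mono hsub) (fun z hz => hW.differentiableAt
        (Metric.isOpen_ball.mem_nhds (hsub (Metric.ball_subset_closedBall hz.1))))
    rw [← h1]
    exact (Complex.imCLM.circleAverage_comp_comm (f := W) (hWc.circleIntegrable'))
  have hW0 : 0 ≤ (W 0).im :=
    le_trans (by positivity) (h 0 (Metric.mem_ball_self (hR.trans hRR)))
  -- The arithmetic-geometric mean inequality with weight s bounds ‖Z‖ by (‖Z‖²/s + s)/2, hence by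
  -- an affine function of Im W, whose circle average is its value at the centre.
  have key : ∀ s : ℝ, 0 < s → R * ‖deriv Z 0‖ ≤ ((W 0).im / a / s + s) / 2 := by
    intro s hs
    rw [← circleAverage_inv_smul_eq_deriv hR hRR hZ]
    have hWi : ContinuousOn (fun z => (a * s * 2 * R)⁻¹ • (W z).im) (Metric.sphere 0 |R|) :=
      continuousOn_const.mul (Complex.continuous_im.comp_continuousOn hWc)
    have h1 : Real.circleAverage (fun z => ‖z⁻¹ • Z z‖) 0 R ≤
        Real.circleAverage (fun z => ((a * s * 2 * R)⁻¹ • (W z).im) + s / (2 * R)) 0 R := by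
      apply Real.circleAverage_mono
      · apply ContinuousOn.circleIntegrable'
        refine ((continuousOn_id.inv₀ fun z hz h0 => ?_).smul hZc).norm
        have := hsph z hz
        simp only [id] at h0
        rw [h0] at this; simp at this; exact hR.ne this
      · apply ContinuousOn.circleIntegrable'
        exact hWi.add continuousOn_const
      · intro z hz
        have h2 := h z (hsub (Metric.sphere_subset_closedBall hz))
        have h3 := hsph z hz
        rw [norm_smul, norm_inv, h3, smul_eq_mul]
        have h4 : ‖Z z‖ ≤ (a * s * 2)⁻¹ * (W z).im + s / 2 := by
          have : 2 * (a * s) * ‖Z z‖ ≤ (W z).im + a * s ^ 2 := by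
            nlinarith [mul_nonneg ha.le (sq_nonneg (‖Z z‖ - s))]
          rw [inv_mul_eq_div, div_add_div _ _ (by positivity) (by positivity),
            le_div_iff₀ (by positivity)]
          nlinarith
        calc R⁻¹ * ‖Z z‖ ≤ R⁻¹ * ((a * s * 2)⁻¹ * (W z).im + s / 2) := by gcongr
          _ = _ := by field_simp
    have h5 : Real.circleAverage (fun z => ((a * s * 2 * R)⁻¹ • (W z).im) + s / (2 * R)) 0 R =
        (a * s * 2 * R)⁻¹ * (W 0).im + s / (2 * R) := by
      rw [Real.circleAverage_fun_add, Real.circleAverage_const, Real.circleAverage_fun_smul,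
        hmeanW, smul_eq_mul]
      · apply ContinuousOn.circleIntegrable'
        exact hWi
      · exact continuousOn_const.circleIntegrable'
    refine (mul_le_mul_of_nonneg_left
      ((norm_circleAverage_le _ _ _).trans (h1.trans h5.le)) hR.le).trans (le_of_eq ?_)
    field_simp
  -- The optimal weight is s = √(Im W(0)/a); when it vanishes, s = R‖Z'(0)‖ gives a contradiction
  -- instead.
  have hlim : R * ‖deriv Z 0‖ ≤ √((W 0).im / a) := by
    rcases hW0.eq_or_lt with h0 | h0
    · rw [← h0]
      simp only [zero_div, Real.sqrt_zero]
      by_contra! hc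
      have := key _ hc
      rw [← h0] at this
      simp only [zero_div] at this
      linarith
    · have hs : 0 < √((W 0).im / a) := Real.sqrt_pos.2 (by positivity)
      have := key _ hs
      rwa [Real.div_sqrt, add_self_div_two] at this
  have h6 := (Real.le_sqrt (by positivity) (by positivity)).1 hlim
  rw [le_div_iff₀ ha] at h6
  nlinarith

/-! ### Patched moduli and localization of holomorphic discs -/

/-- **Maximum principle for patched moduli**: a function that near each point dominates the modulus
of some holomorphic function touching it at that point takes its maximum on the boundary. -/
theorem le_of_forall_sphere_le_of_touching {T : ℂ → ℝ} {ρ M : ℝ} (hρ : 0 < ρ)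
    (hc : ContinuousOn T (Metric.closedBall 0 ρ))
    (ht : ∀ z ∈ Metric.ball (0 : ℂ) ρ, ∃ g : ℂ → ℂ, (∀ᶠ x in 𝓝 z, DifferentiableAt ℂ g x) ∧
      ‖g z‖ = T z ∧ ∀ᶠ x in 𝓝 z, ‖g x‖ ≤ T x)
    (hM : ∀ z ∈ Metric.sphere (0 : ℂ) ρ, T z ≤ M) :
    ∀ z ∈ Metric.closedBall (0 : ℂ) ρ, T z ≤ M := by
  have hK : IsCompact (Metric.closedBall (0 : ℂ) ρ) := isCompact_closedBall 0 ρ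
  obtain ⟨z₀, hz₀, hmax⟩ := hK.exists_isMaxOn ⟨0, Metric.mem_closedBall_self hρ.le⟩ hc
  have hA : IsCompact (Metric.closedBall (0 : ℂ) ρ ∩ T ⁻¹' {T z₀}) :=
    hK.of_isClosed_subset (hc.preimage_isClosed_of_isClosed Metric.isClosed_closedBall
      isClosed_singleton) Set.inter_subset_left
  -- Take a maximum point farthest from the origin. If it were interior, the touching function would
  -- have locally constant modulus, so T would be maximal at nearby points farther out as well.
  obtain ⟨z₁, hz₁, hfar⟩ := hA.exists_isMaxOn ⟨z₀, hz₀, rfl⟩ continuous_norm.continuousOn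
  intro z hz
  refine (hmax hz).trans ?_
  rw [← show T z₁ = T z₀ from hz₁.2]
  rcases (mem_closedBall_zero_iff.1 hz₁.1).eq_or_lt with h | h
  · exact hM _ (by simpa using h)
  exfalso
  have hz₁b : z₁ ∈ Metric.ball (0 : ℂ) ρ := by simpa using h
  obtain ⟨g, hg, hgT, hle⟩ := ht z₁ hz₁b
  have hball : ∀ᶠ x in 𝓝 z₁, x ∈ Metric.ball (0 : ℂ) ρ := Metric.isOpen_ball.mem_nhds hz₁b
  have hloc : IsLocalMax (norm ∘ g) z₁ := by
    filter_upwards [hle, hball] with x h1 h2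
    have h3 : T x ≤ T z₀ := hmax (Metric.ball_subset_closedBall h2)
    have h4 : T z₁ = T z₀ := hz₁.2
    simp only [Function.comp]
    linarith
  have hconst := Complex.norm_eventually_eq_of_isLocalMax hg hloc
  have hall : ∀ᶠ x in 𝓝 z₁, ‖x‖ ≤ ‖z₁‖ := by
    filter_upwards [hle, hball, hconst] with x h1 h2 h3
    have h4 : T z₁ = T z₀ := hz₁.2
    exact hfar ⟨Metric.ball_subset_closedBall h2, le_antisymm
      (hmax (Metric.ball_subset_closedBall h2)) (by linarith)⟩
  have hmul : Tendsto (fun s : ℝ => z₁ + s * (if z₁ = 0 then 1 else z₁)) (𝓝[>] 0) (𝓝 z₁) := by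
    have : Continuous (fun s : ℝ => z₁ + s * (if z₁ = 0 then 1 else z₁)) := by fun_prop
    have h0 := this.tendsto 0
    simp only [Complex.ofReal_zero, zero_mul, add_zero] at h0
    exact h0.mono_left nhdsWithin_le_nhds
  obtain ⟨s, hs, hs0⟩ := ((hmul.eventually hall).and self_mem_nhdsWithin).exists
  split_ifs at hs with h0
  · simp [h0] at hs; linarith
  · have : z₁ + s * z₁ = ((1 + s : ℝ) : ℂ) * z₁ := by push_cast; ring
    rw [this, norm_mul, Complex.norm_real, Real.norm_eq_abs, abs_of_pos (by linarith)] at hs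
    have : 0 < ‖z₁‖ := norm_pos_iff.2 h0
    nlinarith

/-- **Schwarz lemma for patched moduli**. -/
theorem le_norm_of_touching {s : ℂ → ℝ} (hc : ContinuousOn s (Metric.ball 0 1))
    (h1 : ∀ z ∈ Metric.ball (0 : ℂ) 1, s z ≤ 1)
    (ht : ∀ z ∈ Metric.ball (0 : ℂ) 1, z ≠ 0 → ∃ g : ℂ → ℂ, (∀ᶠ x in 𝓝 z, DifferentiableAt ℂ g x) ∧
      ‖g z‖ = s z ∧ ∀ᶠ x in 𝓝 z, ‖g x‖ ≤ s x)
    {g₀ : ℂ → ℂ} (hg₀ : ∀ᶠ x in 𝓝 0, DifferentiableAt ℂ g₀ x) (hg00 : g₀ 0 = 0)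
    (hg₀s : ∀ᶠ x in 𝓝 0, ‖g₀ x‖ = s x) :
    ∀ z ∈ Metric.ball (0 : ℂ) 1, s z ≤ ‖z‖ := by
  -- As in the classical Schwarz lemma, the maximum principle is applied to s/|z|. Near 0 this
  -- quotient is the modulus of the holomorphic difference quotient of g₀; elsewhere it is touched
  -- by g(x)/x.
  set T : ℂ → ℝ := fun z => if z = 0 then ‖deriv g₀ 0‖ else s z / ‖z‖ with hT
  have hTs : ∀ z, z ≠ 0 → T z = s z / ‖z‖ := fun z hz => by simp [hT, hz]
  have hd0 : ∀ᶠ x in 𝓝 (0 : ℂ), ‖dslope g₀ 0 x‖ = T x := by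
    filter_upwards [hg₀s] with x hx
    by_cases h0 : x = 0
    · simp [hT, h0]
    · rw [hTs x h0, dslope_of_ne _ h0, slope_def_module, hg00, sub_zero, sub_zero, norm_smul, hx,
        norm_inv, inv_mul_eq_div]
  have hdd : ∀ᶠ x in 𝓝 (0 : ℂ), DifferentiableAt ℂ (dslope g₀ 0) x := by
    obtain ⟨r, hr, hr'⟩ := Metric.eventually_nhds_iff_ball.1 hg₀
    have : DifferentiableOn ℂ (dslope g₀ 0) (Metric.ball 0 r) :=
      (Complex.differentiableOn_dslope (Metric.ball_mem_nhds 0 hr)).2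
        fun x hx => (hr' x hx).differentiableWithinAt
    filter_upwards [Metric.ball_mem_nhds (0 : ℂ) hr] with x hx
    exact this.differentiableAt (Metric.isOpen_ball.mem_nhds hx)
  have hTc : ContinuousOn T (Metric.ball 0 1) := by
    intro z hz
    apply ContinuousAt.continuousWithinAt
    by_cases h0 : z = 0
    · subst h0
      exact (hdd.self_of_nhds.continuousAt.norm).congr hd0
    · have h2 : ContinuousAt (fun z => s z / ‖z‖) z :=
        (hc.continuousAt (Metric.isOpen_ball.mem_nhds hz)).div continuous_norm.continuousAt
          (norm_ne_zero_iff.2 h0)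
      refine h2.congr ?_
      filter_upwards [isOpen_ne.mem_nhds h0] with x hx
      exact (hTs x hx).symm
  have hbound : ∀ ρ : ℝ, 0 < ρ → ρ < 1 → ∀ z ∈ Metric.closedBall (0 : ℂ) ρ, T z ≤ 1 / ρ := by
    intro ρ hρ hρ1
    have hsub : Metric.closedBall (0 : ℂ) ρ ⊆ Metric.ball 0 1 := Metric.closedBall_subset_ball hρ1
    refine le_of_forall_sphere_le_of_touching hρ (hTc.mono hsub) ?_ ?_
    · intro z hz
      by_cases h0 : z = 0
      · subst h0
        exact ⟨dslope g₀ 0, hdd, hd0.self_of_nhds, hd0.mono fun x hx => hx.le⟩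
      · obtain ⟨g, hg, hgs, hgle⟩ := ht z (hsub (Metric.ball_subset_closedBall hz)) h0
        refine ⟨fun x => g x / x, ?_, ?_, ?_⟩
        · filter_upwards [hg, isOpen_ne.mem_nhds h0] with x hx hx0
          exact hx.div differentiableAt_id hx0
        · rw [hTs z h0, norm_div, hgs]
        · filter_upwards [hgle, isOpen_ne.mem_nhds h0] with x hx hx0
          rw [hTs x hx0, norm_div]
          gcongr
    · intro z hz
      have hzn : ‖z‖ = ρ := by simpa using hz
      have h0 : z ≠ 0 := by rw [← norm_pos_iff, hzn]; exact hρ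
      rw [hTs z h0, hzn]
      have := h1 z (hsub (Metric.sphere_subset_closedBall hz))
      gcongr
  intro z hz
  by_cases h0 : z = 0
  · subst h0
    rw [← hg₀s.self_of_nhds, hg00]
  have hz0 : 0 < ‖z‖ := norm_pos_iff.2 h0
  have hz1 : ‖z‖ < 1 := by simpa using hz
  have hlim : Tendsto (fun ρ : ℝ => 1 / ρ) (𝓝[<] 1) (𝓝 (1 / 1)) :=
    (tendsto_const_nhds.div tendsto_id one_ne_zero).mono_left nhdsWithin_le_nhds
  have : T z ≤ 1 / 1 := by
    refine ge_of_tendsto hlim ?_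
    filter_upwards [Ioo_mem_nhdsLT hz1] with ρ hρ
    exact hbound ρ (hz0.trans hρ.1) hρ.2 z (by simpa using hρ.1.le)
  rw [hTs z h0, div_one, div_le_one hz0] at this
  exact this

/-- The Blaschke factor of the upper half-plane with zero `w₀`, damped by `exp (i m w)`. -/
noncomputable def dampedBlaschke (w₀ : ℂ) (m : ℝ) (w : ℂ) : ℂ :=
  (w - w₀) / (w - (starRingEnd ℂ) w₀) * Complex.exp (Complex.I * m * w)

theorem norm_exp_I_mul (m : ℝ) (w : ℂ) :
    ‖Complex.exp (Complex.I * m * w)‖ = Real.exp (-(m * w.im)) := by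
  rw [Complex.norm_exp]; simp

theorem sub_conj_ne_zero {w₀ w : ℂ} (h₀ : 0 < w₀.im) (h : 0 < w.im) :
    w - (starRingEnd ℂ) w₀ ≠ 0 := by
  intro h1
  have := congrArg Complex.im h1
  simp at this
  linarith

theorem norm_sub_le_norm_sub_conj {w₀ w : ℂ} (h₀ : 0 < w₀.im) (h : 0 < w.im) :
    ‖w - w₀‖ ≤ ‖w - (starRingEnd ℂ) w₀‖ := by
  rw [← sq_le_sq₀ (norm_nonneg _) (norm_nonneg _), Complex.sq_norm, Complex.sq_norm,
    Complex.normSq_apply, Complex.normSq_apply]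
  simp
  nlinarith [mul_pos h₀ h]

theorem differentiableAt_dampedBlaschke {w₀ w : ℂ} (m : ℝ) (h₀ : 0 < w₀.im) (h : 0 < w.im) :
    DifferentiableAt ℂ (dampedBlaschke w₀ m) w := by
  unfold dampedBlaschke
  have := sub_conj_ne_zero h₀ h
  fun_prop (disch := assumption)

theorem norm_dampedBlaschke_le_exp {w₀ w : ℂ} (m : ℝ) (h₀ : 0 < w₀.im) (h : 0 < w.im) :
    ‖dampedBlaschke w₀ m w‖ ≤ Real.exp (-(m * w.im)) := by
  rw [dampedBlaschke, norm_mul, norm_div, norm_exp_I_mul]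
  refine mul_le_of_le_one_left (Real.exp_pos _).le ?_
  rw [div_le_one (norm_pos_iff.2 (sub_conj_ne_zero h₀ h))]
  exact norm_sub_le_norm_sub_conj h₀ h

theorem norm_dampedBlaschke_le_one {w₀ w : ℂ} {m : ℝ} (hm : 0 ≤ m) (h₀ : 0 < w₀.im)
    (h : 0 < w.im) : ‖dampedBlaschke w₀ m w‖ ≤ 1 := by
  refine (norm_dampedBlaschke_le_exp m h₀ h).trans (Real.exp_le_one_iff.2 ?_)
  have := mul_nonneg hm h.le
  linarith

/-- The numerator and denominator of the Blaschke factor differ by w₀ - conj w₀, of size at most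
2|w₀|; away from the zero its modulus is therefore 1 - O(|w₀|). -/
theorem one_sub_mul_exp_le_norm_dampedBlaschke {w₀ w : ℂ} {m γ γ₁ : ℝ} (hm : 0 ≤ m)
    (hγ₁ : 0 < γ₁) (hw₀ : ‖w₀‖ ≤ γ₁ / 8) (hw : γ₁ ≤ ‖w‖)
    (hw' : ‖w‖ ≤ γ) :
    (1 - 4 * ‖w₀‖ / γ₁) * Real.exp (-(m * γ)) ≤ ‖dampedBlaschke w₀ m w‖ := by
  rw [dampedBlaschke, norm_mul, norm_div, norm_exp_I_mul]
  have h1 : γ₁ / 2 ≤ ‖w - (starRingEnd ℂ) w₀‖ := by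
    have := norm_sub_norm_le w ((starRingEnd ℂ) w₀)
    rw [RCLike.norm_conj] at this
    linarith
  have h2 : ‖w - (starRingEnd ℂ) w₀‖ - 2 * ‖w₀‖ ≤ ‖w - w₀‖ := by
    have h3 : w - w₀ = (w - (starRingEnd ℂ) w₀) - (w₀ - (starRingEnd ℂ) w₀) := by ring
    have h4 := norm_sub_norm_le (w - (starRingEnd ℂ) w₀) (w₀ - (starRingEnd ℂ) w₀)
    have h5 := norm_sub_le w₀ ((starRingEnd ℂ) w₀)
    rw [RCLike.norm_conj] at h5
    rw [h3]
    linarith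
  refine mul_le_mul ?_ ?_ (Real.exp_pos _).le (by positivity)
  · rw [le_div_iff₀ (by linarith)]
    have h6 : 2 * ‖w₀‖ ≤ 4 * ‖w₀‖ / γ₁ * ‖w - (starRingEnd ℂ) w₀‖ := by
      calc 2 * ‖w₀‖ = 4 * ‖w₀‖ / γ₁ * (γ₁ / 2) := by field_simp; ring
        _ ≤ _ := by gcongr
    linarith
  · apply Real.exp_le_exp.2
    have := (Complex.im_le_norm w).trans hw'
    have := mul_le_mul_of_nonneg_left this hm
    linarith

/-- **Localization of holomorphic discs at a peak point.** If `h` is a holomorphic function near `p`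
with `Im h ≥ c ‖Z - p‖²` on `D`, then holomorphic discs in `D` with centre near `p` stay near `p`,
except possibly for a boundary collar of width controlled by the value of `h` at the centre. -/
theorem disc_localization {X : Type*} [NormedAddCommGroup X] [NormedSpace ℂ X] {D V : Set X}
    {p : X} {h : X → ℂ} {c : ℝ} (hc : 0 < c) (hV : IsOpen V) (hpV : p ∈ V) (hpD : p ∉ D)
    (hh : DifferentiableOn ℂ h V) (h0 : h p = 0)
    (hpk : ∀ Z ∈ V, Z ∈ D → c * ‖Z - p‖ ^ 2 ≤ (h Z).im) {O : Set X} (hO : O ∈ 𝓝 p) :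
    ∃ K > 0, ∃ O₀ ∈ 𝓝 p, ∀ f : ℂ → X, DifferentiableOn ℂ f (Metric.ball 0 1) →
      Set.MapsTo f (Metric.ball 0 1) D → f 0 ∈ O₀ →
        ∀ ζ : ℂ, ‖ζ‖ < 1 - K * ‖h (f 0)‖ → f ζ ∈ O := by
  obtain ⟨R, hR, hRV⟩ := Metric.mem_nhds_iff.1 (inter_mem (hV.mem_nhds hpV) hO)
  -- On D, Im h ≥ γ on the outer collar R/2 ≤ ‖Z - p‖ < R, whereas |h| < γ/4 on the inner collar r₁
  -- ≤ ‖Z - p‖ < 2r₁. The damping exploits this gap.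
  set γ : ℝ := c * (R / 2) ^ 2 with hγdef
  have hγ : 0 < γ := by positivity
  have hcont : ContinuousAt h p := (hh.differentiableAt (hV.mem_nhds hpV)).continuousAt
  obtain ⟨r, hr, hrh⟩ := Metric.eventually_nhds_iff_ball.1
    (hcont.norm.eventually (gt_mem_nhds (show ‖h p‖ < γ / 4 by rw [h0, norm_zero]; positivity)))
  set r₁ : ℝ := min (r / 2) (R / 4) with hr₁def
  have hr₁ : 0 < r₁ := by positivity
  have hr₁r : 2 * r₁ ≤ r := by linarith [min_le_left (r / 2) (R / 4)]
  have hr₁R : 2 * r₁ ≤ R / 2 := by linarith [min_le_right (r / 2) (R / 4)]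
  set γ₁ : ℝ := c * r₁ ^ 2 with hγ₁def
  have hγ₁ : 0 < γ₁ := by positivity
  refine ⟨16 / γ₁, by positivity, Metric.ball p r₁ ∩ {Z | ‖h Z‖ < γ₁ / 8}, ?_, ?_⟩
  · refine inter_mem (Metric.ball_mem_nhds p hr₁) (hcont.norm.eventually (gt_mem_nhds
      (show ‖h p‖ < γ₁ / 8 from ?_)))
    rw [h0, norm_zero]; positivity
  rintro f hf hfD ⟨hf0, hf0'⟩ ζ₁ hζ₁
  have hf0' : ‖h (f 0)‖ < γ₁ / 8 := hf0'
  have hdist : ∀ Z, dist Z p = ‖Z - p‖ := fun Z => dist_eq_norm _ _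
  have him : ∀ z ∈ Metric.ball (0 : ℂ) 1, ‖f z - p‖ < R → c * ‖f z - p‖ ^ 2 ≤ (h (f z)).im :=
    fun z hz hzR => hpk _ (hRV (by rwa [Metric.mem_ball, hdist])).1 (hfD hz)
  have hpos : ∀ z ∈ Metric.ball (0 : ℂ) 1, ‖f z - p‖ < R → 0 < (h (f z)).im := by
    intro z hz hzR
    refine lt_of_lt_of_le ?_ (him z hz hzR)
    have : f z - p ≠ 0 := fun h1 => hpD (by rw [← sub_eq_zero.1 h1]; exact hfD hz)
    have := norm_pos_iff.2 this
    positivity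
  have h0b : (0 : ℂ) ∈ Metric.ball (0 : ℂ) 1 := by simp
  rw [Metric.mem_ball, hdist] at hf0
  set w₀ : ℂ := h (f 0) with hw₀def
  have hw₀ : 0 < w₀.im := hpos 0 h0b (by linarith)
  have hw₀n : 0 < ‖w₀‖ := lt_of_lt_of_le hw₀ (Complex.im_le_norm _)
  set u : ℝ := 4 * ‖w₀‖ / γ₁ with hu
  have hu0 : 0 < u := by positivity
  have hu1 : u < 1 / 2 := by rw [hu, div_lt_iff₀ hγ₁]; linarith
  -- With mγ = 8u, the damped factor is at least (1 - u)e^(-2u) on the inner collar and at most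
  -- e^(-8u) on the outer one, and κ = e^(-4u) lies strictly between. The bound κ ≥ 1 - 4u explains
  -- K = 16/γ₁.
  set m : ℝ := 8 * u / γ with hm
  have hm0 : 0 < m := by positivity
  have hmγ : m * (γ / 4) = 2 * u := by rw [hm]; field_simp; ring
  set κ : ℝ := Real.exp (-(m * (γ / 2))) with hκ
  have hκpos : 0 < κ := Real.exp_pos _
  have hκ1 : κ ≤ 1 := Real.exp_le_one_iff.2 (by have := mul_pos hm0 hγ; linarith)
  have hκlow : 1 - 16 / γ₁ * ‖w₀‖ ≤ κ := by
    have h1 := Real.add_one_le_exp (-(m * (γ / 2)))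
    have h2 : m * (γ / 2) = 16 / γ₁ * ‖w₀‖ := by
      have : m * (γ / 2) = 4 * u := by linarith
      rw [this, hu]; ring
    linarith
  have hκu : κ < (1 - u) * Real.exp (-(m * (γ / 4))) := by
    have h1 : κ = Real.exp (-(2 * u)) * Real.exp (-(m * (γ / 4))) := by
      rw [hκ, ← Real.exp_add]; congr 1; linarith
    rw [h1]
    refine mul_lt_mul_of_pos_right ?_ (Real.exp_pos _)
    rw [Real.exp_neg]
    have h2 := Real.add_one_le_exp (2 * u)
    rw [inv_lt_iff_one_lt_mul₀ (Real.exp_pos _)]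
    nlinarith
  have hζ1 : ‖ζ₁‖ < κ := lt_of_lt_of_le hζ₁ hκlow
  have hζb : ζ₁ ∈ Metric.ball (0 : ℂ) 1 := by simpa using hζ1.trans_le hκ1
  set H : ℂ → ℂ := fun z => dampedBlaschke w₀ m (h (f z)) with hH
  set d : ℂ → ℝ := fun z => ‖f z - p‖ with hd
  have hdc : ∀ z ∈ Metric.ball (0 : ℂ) 1, ContinuousAt d z := fun z hz =>
    ((hf.differentiableAt (Metric.isOpen_ball.mem_nhds hz)).continuousAt.sub
      continuousAt_const).norm
  have hHd : ∀ z ∈ Metric.ball (0 : ℂ) 1, d z < R → DifferentiableAt ℂ H z := by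
    intro z hz hzR
    have h1 : f z ∈ V := (hRV (by rwa [Metric.mem_ball, hdist])).1
    exact (differentiableAt_dampedBlaschke m hw₀ (hpos z hz hzR)).comp z
      ((hh.differentiableAt (hV.mem_nhds h1)).comp z
        (hf.differentiableAt (Metric.isOpen_ball.mem_nhds hz)))
  have hH1 : ∀ z ∈ Metric.ball (0 : ℂ) 1, d z < R → ‖H z‖ ≤ 1 := fun z hz hzR =>
    norm_dampedBlaschke_le_one hm0.le hw₀ (hpos z hz hzR)
  have hHin : ∀ z ∈ Metric.ball (0 : ℂ) 1, r₁ ≤ d z → d z < 2 * r₁ → κ ≤ ‖H z‖ := by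
    intro z hz h1 h2
    have hzR : d z < R := by linarith
    have h3 : ‖h (f z)‖ < γ / 4 := hrh _ (by rw [Metric.mem_ball, hdist]; exact h2.trans_le hr₁r)
    have h4 : γ₁ ≤ ‖h (f z)‖ := by
      refine le_trans ?_ ((him z hz hzR).trans (Complex.im_le_norm _))
      rw [hγ₁def]
      gcongr
    exact hκu.le.trans (one_sub_mul_exp_le_norm_dampedBlaschke hm0.le hγ₁ hf0'.le h4 h3.le)
  have hHout : ∀ z ∈ Metric.ball (0 : ℂ) 1, R / 2 ≤ d z → d z < R → ‖H z‖ ≤ κ := by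
    intro z hz h1 h2
    have h3 : γ ≤ (h (f z)).im := by
      refine le_trans ?_ (him z hz h2)
      rw [hγdef]
      gcongr
    refine (norm_dampedBlaschke_le_exp m hw₀ (hpos z hz h2)).trans (Real.exp_le_exp.2 ?_)
    have := mul_le_mul_of_nonneg_left h3 hm0.le
    have := mul_pos hm0 hγ
    linarith
  -- Here |H| is glued to the constant κ through a maximum; the collar inequalities make the pieces
  -- agree on overlaps. Thus s is a patched modulus on the whole disc although h is controlled only
  -- near p, and it vanishes at 0 because w₀ = h (f 0).
  set s : ℂ → ℝ := fun z => if d z < r₁ then ‖H z‖ else if d z < R then max ‖H z‖ κ else κ with hs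
  have hs_near : ∀ z ∈ Metric.ball (0 : ℂ) 1, d z < 2 * r₁ → s z = ‖H z‖ := by
    intro z hz h1
    simp only [hs]
    split_ifs with h2 h3
    · rfl
    · exact max_eq_left (hHin z hz (not_lt.1 h2) h1)
    · linarith
  have hs_mid : ∀ z ∈ Metric.ball (0 : ℂ) 1, r₁ < d z → d z < R → s z = max ‖H z‖ κ := by
    intro z hz h1 h2
    simp only [hs]
    rw [if_neg h1.not_gt, if_pos h2]
  have hs_far : ∀ z ∈ Metric.ball (0 : ℂ) 1, R / 2 < d z → s z = κ := by
    intro z hz h1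
    simp only [hs]
    rw [if_neg (by linarith)]
    split_ifs with h2
    · exact max_eq_right (hHout z hz h1.le h2)
    · rfl
  have hbn : ∀ z ∈ Metric.ball (0 : ℂ) 1, ∀ᶠ x in 𝓝 z, x ∈ Metric.ball (0 : ℂ) 1 :=
    fun z hz => Metric.isOpen_ball.mem_nhds hz
  have hnear : ∀ z ∈ Metric.ball (0 : ℂ) 1, d z < 2 * r₁ → ∀ᶠ x in 𝓝 z, ‖H x‖ = s x := by
    intro z hz h1
    filter_upwards [hbn z hz, (hdc z hz).eventually (gt_mem_nhds h1)] with x hx hx1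
    exact (hs_near x hx hx1).symm
  have hmid : ∀ z ∈ Metric.ball (0 : ℂ) 1, r₁ < d z → d z < R →
      ∀ᶠ x in 𝓝 z, max ‖H x‖ κ = s x := by
    intro z hz h1 h2
    filter_upwards [hbn z hz, (hdc z hz).eventually (gt_mem_nhds h2),
      (hdc z hz).eventually (lt_mem_nhds h1)] with x hx hx1 hx2
    exact (hs_mid x hx hx2 hx1).symm
  have hfar : ∀ z ∈ Metric.ball (0 : ℂ) 1, R / 2 < d z → ∀ᶠ x in 𝓝 z, κ = s x := by
    intro z hz h1
    filter_upwards [hbn z hz, (hdc z hz).eventually (lt_mem_nhds h1)] with x hx hx1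
    exact (hs_far x hx hx1).symm
  have hHdn : ∀ z ∈ Metric.ball (0 : ℂ) 1, d z < R → ∀ᶠ x in 𝓝 z, DifferentiableAt ℂ H x := by
    intro z hz h1
    filter_upwards [hbn z hz, (hdc z hz).eventually (gt_mem_nhds h1)] with x hx hx1
    exact hHd x hx hx1
  have hκn : ‖(κ : ℂ)‖ = κ := by rw [Complex.norm_real, Real.norm_eq_abs, abs_of_pos hκpos]
  have hcases : ∀ z, d z < 2 * r₁ ∨ (r₁ < d z ∧ d z < R) ∨ R / 2 < d z := by
    intro z
    rcases lt_or_ge (d z) (2 * r₁) with h1 | h1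
    · exact Or.inl h1
    · rcases lt_or_ge (d z) R with h2 | h2
      · exact Or.inr (Or.inl ⟨by linarith, h2⟩)
      · exact Or.inr (Or.inr (by linarith))
  have hsc : ContinuousOn s (Metric.ball 0 1) := by
    intro z hz
    apply ContinuousAt.continuousWithinAt
    rcases hcases z with h1 | ⟨h1, h2⟩ | h1
    · exact ((hHd z hz (by linarith)).continuousAt.norm).congr (hnear z hz h1)
    · have hmax : ContinuousAt (fun x => max ‖H x‖ κ) z :=
        (hHd z hz h2).continuousAt.norm.max continuousAt_const
      exact hmax.congr (hmid z hz h1 h2)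
    · exact continuousAt_const.congr (hfar z hz h1)
  have hs1 : ∀ z ∈ Metric.ball (0 : ℂ) 1, s z ≤ 1 := by
    intro z hz
    rcases hcases z with h1 | ⟨h1, h2⟩ | h1
    · rw [hs_near z hz h1]; exact hH1 z hz (by linarith)
    · rw [hs_mid z hz h1 h2]; exact max_le (hH1 z hz h2) hκ1
    · rw [hs_far z hz h1]; exact hκ1
  have hd0 : d 0 < 2 * r₁ := by simp only [hd]; linarith
  have hschwarz := le_norm_of_touching hsc hs1 (fun z hz _ => ?_)
    (hHdn 0 h0b (by linarith)) (by simp [hH, dampedBlaschke, hw₀def]) (hnear 0 h0b hd0) ζ₁ hζb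
  -- At a far point s equals κ, contradicting s(ζ₁) ≤ |ζ₁| < κ.
  · have hdR : d ζ₁ ≤ R / 2 := by
      by_contra! h1
      rw [hs_far ζ₁ hζb h1] at hschwarz
      linarith
    refine (hRV ?_).2
    rw [Metric.mem_ball, hdist]
    change d ζ₁ < R
    linarith
  · rcases hcases z with h1 | ⟨h1, h2⟩ | h1
    · exact ⟨H, hHdn z hz (by linarith), (hnear z hz h1).self_of_nhds,
        (hnear z hz h1).mono fun x hx => hx.le⟩
    · rcases le_total κ ‖H z‖ with h3 | h3
      · refine ⟨H, hHdn z hz h2, ?_, (hmid z hz h1 h2).mono fun x hx => ?_⟩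
        · rw [hs_mid z hz h1 h2, max_eq_left h3]
        · rw [← hx]; exact le_max_left _ _
      · refine ⟨fun _ => (κ : ℂ), Eventually.of_forall fun _ => differentiableAt_const _, ?_,
          (hmid z hz h1 h2).mono fun x hx => ?_⟩
        · rw [hs_mid z hz h1 h2, max_eq_right h3, hκn]
        · rw [← hx, hκn]; exact le_max_right _ _
    · exact ⟨fun _ => (κ : ℂ), Eventually.of_forall fun _ => differentiableAt_const _,
        by rw [hs_far z hz h1, hκn], (hfar z hz h1).mono fun x hx => by rw [← hx, hκn]⟩

/-! ### First-order properties of normal coordinates -/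

namespace IsNormalCoord

variable {n : ℕ} {D : Set (AmbientSpace n)} {p : AmbientSpace n}
  {φ : OpenPartialHomeomorph (AmbientSpace n) (CoordSpace n)}

theorem zero_mem_target (hφ : IsNormalCoord D p φ) : (0 : CoordSpace n) ∈ φ.target := by
  rw [← hφ.map_base]; exact φ.map_source hφ.mem_source

theorem symm_zero (hφ : IsNormalCoord D p φ) : φ.symm 0 = p := by
  rw [← hφ.map_base]; exact φ.left_inv hφ.mem_source

theorem hasFDerivAt (hφ : IsNormalCoord D p φ) : HasFDerivAt φ (fderiv ℂ φ p) p :=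
  (hφ.holomorphic.differentiableAt (φ.open_source.mem_nhds hφ.mem_source)).hasFDerivAt

theorem hasFDerivAt_symm_fderiv (hφ : IsNormalCoord D p φ) :
    HasFDerivAt φ.symm (fderiv ℂ φ.symm 0) 0 :=
  (hφ.holomorphic_symm.differentiableAt
    (φ.open_target.mem_nhds hφ.zero_mem_target)).hasFDerivAt

/-- The differential at the base point of a normal coordinate system. -/
noncomputable def tangentEquiv (hφ : IsNormalCoord D p φ) : AmbientSpace n ≃L[ℂ] CoordSpace n :=
  ContinuousLinearEquiv.equivOfInverse (fderiv ℂ φ p) (fderiv ℂ φ.symm 0)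
    (fun v => by
      have h1 : HasFDerivAt (φ.symm ∘ φ) ((fderiv ℂ φ.symm 0).comp (fderiv ℂ φ p)) p :=
        HasFDerivAt.comp p (by rw [hφ.map_base]; exact hφ.hasFDerivAt_symm_fderiv) hφ.hasFDerivAt
      have h2 : HasFDerivAt (φ.symm ∘ φ) (ContinuousLinearMap.id ℂ (AmbientSpace n)) p :=
        (hasFDerivAt_id p).congr_of_eventuallyEq (φ.eventually_left_inverse hφ.mem_source)
      exact congrArg (fun T => T v) (h1.unique h2))
    (fun v => by
      have h1 : HasFDerivAt (φ ∘ φ.symm) ((fderiv ℂ φ p).comp (fderiv ℂ φ.symm 0)) 0 :=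
        HasFDerivAt.comp 0 (by rw [hφ.symm_zero]; exact hφ.hasFDerivAt)
          hφ.hasFDerivAt_symm_fderiv
      have h2 : HasFDerivAt (φ ∘ φ.symm) (ContinuousLinearMap.id ℂ (CoordSpace n)) 0 :=
        (hasFDerivAt_id 0).congr_of_eventuallyEq
          (φ.eventually_right_inverse hφ.zero_mem_target)
      exact congrArg (fun T => T v) (h1.unique h2))

theorem tangentEquiv_apply (hφ : IsNormalCoord D p φ) (v : AmbientSpace n) :
    hφ.tangentEquiv v = fderiv ℂ φ p v := rfl

theorem hasFDerivAt_coe (hφ : IsNormalCoord D p φ) :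
    HasFDerivAt φ (hφ.tangentEquiv : AmbientSpace n →L[ℂ] CoordSpace n) p := hφ.hasFDerivAt

theorem hasFDerivAt_symm (hφ : IsNormalCoord D p φ) :
    HasFDerivAt φ.symm (hφ.tangentEquiv.symm : CoordSpace n →L[ℂ] AmbientSpace n) 0 :=
  hφ.hasFDerivAt_symm_fderiv

theorem tendsto_symm (hφ : IsNormalCoord D p φ) : Tendsto φ.symm (𝓝 0) (𝓝 p) := by
  have := hφ.hasFDerivAt_symm.continuousAt.tendsto
  rwa [hφ.symm_zero] at this

theorem tendsto (hφ : IsNormalCoord D p φ) : Tendsto φ (𝓝 p) (𝓝 0) := by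
  have := hφ.hasFDerivAt.continuousAt.tendsto
  rwa [hφ.map_base] at this

/-- The remainder r matters only through |r| ≤ M‖ζ‖³. This lemma and the next are the two one-sided
forms: a sufficient and a necessary condition for membership in D. -/
theorem exists_mem_of_lt_im (hφ : IsNormalCoord D p φ) :
    ∃ M > 0, ∀ᶠ ζ in 𝓝 (0 : CoordSpace n), ‖ζ.1‖ ^ 2 + M * ‖ζ‖ ^ 3 < ζ.2.im → φ.symm ζ ∈ D := by
  obtain ⟨r, W, -, -, -, hr, hD⟩ := hφ.normal_form
  obtain ⟨M, hM, hMr⟩ := hr.exists_pos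
  refine ⟨M, hM, ?_⟩
  filter_upwards [hMr.bound, hφ.tendsto_symm.eventually hD,
    φ.open_target.mem_nhds hφ.zero_mem_target] with ζ h1 h2 h3 h4
  rw [h2, φ.right_inv h3]
  rw [Real.norm_eq_abs, norm_pow, norm_norm] at h1
  linarith [le_abs_self (r ζ)]

theorem exists_lt_im_of_mem (hφ : IsNormalCoord D p φ) :
    ∃ M > 0, ∀ᶠ Z in 𝓝 p, Z ∈ D → ‖(φ Z).1‖ ^ 2 - M * ‖φ Z‖ ^ 3 < (φ Z).2.im := by
  obtain ⟨r, W, -, -, -, hr, hD⟩ := hφ.normal_form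
  obtain ⟨M, hM, hMr⟩ := hr.exists_pos
  refine ⟨M, hM, ?_⟩
  filter_upwards [hφ.tendsto.eventually hMr.bound, hD] with Z h1 h2 h3
  rw [h2] at h3
  rw [Real.norm_eq_abs, norm_pow, norm_norm] at h1
  linarith [neg_abs_le (r (φ Z))]

end IsNormalCoord

/-! ### Cones and non-tangential approach -/

/-- The punctured neighbourhoods of the origin in a cone around the inner normal direction. -/
noncomputable def normalCone (n : ℕ) (c : ℝ) : Filter (CoordSpace n) :=
  𝓝[{ζ | 0 < ζ.2.im ∧ ‖ζ‖ ≤ c * ζ.2.im}] 0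

theorem normalCone_le_nhds (n : ℕ) (c : ℝ) : normalCone n c ≤ 𝓝 0 := nhdsWithin_le_nhds

theorem eventually_normalCone_mem (n : ℕ) (c : ℝ) :
    ∀ᶠ ζ in normalCone n c, 0 < ζ.2.im ∧ ‖ζ‖ ≤ c * ζ.2.im := self_mem_nhdsWithin

theorem CoordSpace.im_le_norm {n : ℕ} (ζ : CoordSpace n) : |ζ.2.im| ≤ ‖ζ‖ :=
  (Complex.abs_im_le_norm _).trans (norm_snd_le ζ)

theorem sq_add_cube_lt {c M y : ℝ} (hc : 0 ≤ c) (hM : 0 ≤ M) (hy : 0 < y) (hy1 : y ≤ 1)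
    (h : y * ((c + 1) ^ 2 * (1 + M * (c + 1))) ≤ 1 / 4) :
    ((c + 1) * y) ^ 2 + M * ((c + 1) * y) ^ 3 < 3 / 4 * y := by
  have h1 : y ^ 3 ≤ y ^ 2 := pow_le_pow_of_le_one hy.le hy1 (by norm_num)
  have h2 : M * (c + 1) ^ 3 * y ^ 3 ≤ M * (c + 1) ^ 3 * y ^ 2 := by gcongr
  have h3 := mul_le_mul_of_nonneg_left h hy.le
  calc ((c + 1) * y) ^ 2 + M * ((c + 1) * y) ^ 3
      = (c + 1) ^ 2 * y ^ 2 + M * (c + 1) ^ 3 * y ^ 3 := by ring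
    _ ≤ (c + 1) ^ 2 * y ^ 2 + M * (c + 1) ^ 3 * y ^ 2 := by linarith
    _ = y * (y * ((c + 1) ^ 2 * (1 + M * (c + 1)))) := by ring
    _ < 3 / 4 * y := by linarith

/-- Cones around the inner normal consist of non-tangential points. -/
theorem IsNormalCoord.tendsto_symm_normalCone {n : ℕ} {D : Set (AmbientSpace n)}
    {p : AmbientSpace n} {φ : OpenPartialHomeomorph (AmbientSpace n) (CoordSpace n)}
    (hφ : IsNormalCoord D p φ) (hD : IsOpen D) (hp : p ∈ frontier D) {c : ℝ} (hc : 0 < c) :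
    ∃ c' : ℝ, Tendsto φ.symm (normalCone n c)
      (𝓝[{Z | Z ∈ D ∧ dist Z p ≤ c' * Metric.infDist Z (frontier D)}] p) := by
  obtain ⟨M, hM, hMD⟩ := hφ.exists_mem_of_lt_im
  obtain ⟨K, hK, hKb⟩ := (hφ.hasFDerivAt_symm.isBigO_sub).exists_pos
  have hKb := hKb.bound
  simp only [hφ.symm_zero, sub_zero] at hKb
  set N : ℝ := ‖(hφ.tangentEquiv : AmbientSpace n →L[ℂ] CoordSpace n)‖ + 1 with hN
  have hN1 : 1 ≤ N := by rw [hN]; linarith [norm_nonneg (hφ.tangentEquiv : AmbientSpace n →L[ℂ] CoordSpace n)]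
  -- A displacement by less than ηy changes the linear part of φ by at most y/8, and the choice of ε
  -- bounds the two linearization errors by y/8 together. The imaginary part then stays above 3y/4.
  set η : ℝ := 1 / (8 * N) with hη
  have hη0 : 0 < η := by positivity
  have hη1 : η ≤ 1 := by rw [hη, div_le_one (by positivity)]; linarith
  have hNη : N * η = 1 / 8 := by rw [hη]; field_simp
  set ε : ℝ := 1 / (8 * (2 * K * c + 1)) with hε
  have hε0 : 0 < ε := by positivity
  have hεm : ε * (2 * K * c + 1) = 1 / 8 := by rw [hε]; field_simp
  have hlin := hφ.hasFDerivAt_coe.isLittleO.def hε0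
  simp only [hφ.map_base, sub_zero] at hlin
  have hsource : ∀ᶠ Z in 𝓝 p, Z ∈ φ.source := φ.open_source.mem_nhds hφ.mem_source
  obtain ⟨ρ, hρ, hρb⟩ := Metric.eventually_nhds_iff_ball.1
    (hlin.and (hsource.and (hφ.tendsto.eventually hMD)))
  set τ : ℝ := min (ρ / (K * c + 1)) (1 / (4 * (c + 1) ^ 2 * (1 + M * (c + 1)))) with hτ
  have hτ0 : 0 < τ := by positivity
  have hball : ∀ᶠ ζ in normalCone n c, ∀ Z', dist Z' (φ.symm ζ) < η * ζ.2.im → Z' ∈ D := by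
    filter_upwards [eventually_normalCone_mem n c, (normalCone_le_nhds n c) hKb,
      (normalCone_le_nhds n c) (φ.open_target.mem_nhds hφ.zero_mem_target),
      (normalCone_le_nhds n c) (Metric.ball_mem_nhds 0 (lt_min hτ0 one_pos))] with ζ h1 h2 h3 h4
    intro Z' hZ'
    obtain ⟨hy, hcone⟩ := h1
    set y := ζ.2.im with hydef
    have h2 : ‖φ.symm ζ - p‖ ≤ K * ‖ζ‖ := h2
    have hyn : y ≤ ‖ζ‖ := (le_abs_self _).trans ζ.im_le_norm
    rw [mem_ball_zero_iff, lt_min_iff] at h4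
    have hyτ : y < τ := hyn.trans_lt h4.1
    have hy1 : y < 1 := hyn.trans_lt h4.2
    have hyρ : (K * c + 1) * y < ρ := by
      have := hyτ.trans_le (min_le_left _ _)
      rw [lt_div_iff₀ (by positivity)] at this
      linarith
    have hZp : ‖φ.symm ζ - p‖ ≤ K * c * y := h2.trans (by
      rw [mul_assoc]; gcongr)
    rw [dist_eq_norm] at hZ'
    have hZ'p : ‖Z' - p‖ ≤ (K * c + η) * y := by
      have := norm_add_le (Z' - φ.symm ζ) (φ.symm ζ - p)
      rw [sub_add_sub_cancel] at this
      linarith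
    have hmem : ∀ Y, ‖Y - p‖ ≤ (K * c + η) * y → Y ∈ Metric.ball p ρ := fun Y hY => by
      rw [Metric.mem_ball, dist_eq_norm]
      refine hY.trans_lt (lt_of_le_of_lt ?_ hyρ)
      gcongr
    obtain ⟨a1, -, -⟩ := hρb _ (hmem (φ.symm ζ) (hZp.trans (by
      have := mul_pos hη0 hy
      linarith)))
    obtain ⟨b1, b2, b3⟩ := hρb _ (hmem Z' hZ'p)
    rw [φ.right_inv h3] at a1
    have hdiff : ‖φ Z' - ζ‖ ≤ y / 4 := by
      have e : φ Z' - ζ = hφ.tangentEquiv (Z' - φ.symm ζ) +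
          ((φ Z' - hφ.tangentEquiv (Z' - p)) - (ζ - hφ.tangentEquiv (φ.symm ζ - p))) := by
        rw [map_sub, map_sub, map_sub]; abel
      have e1 : ‖hφ.tangentEquiv (Z' - φ.symm ζ)‖ ≤ N * (η * y) := by
        refine ((hφ.tangentEquiv : AmbientSpace n →L[ℂ] CoordSpace n).le_opNorm _).trans ?_
        have : ‖(hφ.tangentEquiv : AmbientSpace n →L[ℂ] CoordSpace n)‖ ≤ N := by
          rw [hN]; linarith
        gcongr
      have e2 : ‖φ Z' - hφ.tangentEquiv (Z' - p)‖ ≤ ε * ((K * c + η) * y) :=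
        b1.trans (by gcongr)
      have e3 : ‖ζ - hφ.tangentEquiv (φ.symm ζ - p)‖ ≤ ε * (K * c * y) :=
        a1.trans (by gcongr)
      have e4 := norm_add_le (hφ.tangentEquiv (Z' - φ.symm ζ))
        ((φ Z' - hφ.tangentEquiv (Z' - p)) - (ζ - hφ.tangentEquiv (φ.symm ζ - p)))
      have e5 := norm_sub_le (φ Z' - hφ.tangentEquiv (Z' - p))
        (ζ - hφ.tangentEquiv (φ.symm ζ - p))
      rw [← e] at e4
      have e6 : N * (η * y) = y / 8 := by rw [← mul_assoc, hNη]; ring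
      have e7 : ε * ((K * c + η) * y) + ε * (K * c * y) ≤ y / 8 := by
        have : ε * ((K * c + η) * y) + ε * (K * c * y) = ε * (2 * K * c + η) * y := by ring
        rw [this]
        have : ε * (2 * K * c + η) ≤ ε * (2 * K * c + 1) := by gcongr
        rw [hεm] at this
        nlinarith
      linarith
    have hζ' : ‖φ Z'‖ ≤ (c + 1) * y := by
      have := norm_add_le (φ Z' - ζ) ζ
      rw [sub_add_cancel] at this
      linarith
    have him : 3 / 4 * y ≤ (φ Z').2.im := by
      have := (φ Z' - ζ).im_le_norm.trans hdiff
      rw [abs_le] at this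
      have h5 : (φ Z' - ζ).2.im = (φ Z').2.im - y := by simp [hydef]
      linarith
    rw [← φ.left_inv b2]
    refine b3 (lt_of_lt_of_le ?_ him)
    have h6 : ‖(φ Z').1‖ ≤ (c + 1) * y := (norm_fst_le _).trans hζ'
    have h7 : ‖(φ Z').1‖ ^ 2 + M * ‖φ Z'‖ ^ 3 ≤ ((c + 1) * y) ^ 2 + M * ((c + 1) * y) ^ 3 := by
      gcongr
    have h9 : y * ((c + 1) ^ 2 * (1 + M * (c + 1))) < 1 / 4 := by
      have := hyτ.trans_le (min_le_right _ _)
      rw [lt_div_iff₀ (by positivity)] at this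
      linarith
    exact h7.trans_lt (sq_add_cube_lt hc.le hM.le hy hy1.le h9.le)
  refine ⟨K * c / η, tendsto_nhdsWithin_iff.2
    ⟨hφ.tendsto_symm.mono_left (normalCone_le_nhds n c), ?_⟩⟩
  filter_upwards [hball, eventually_normalCone_mem n c, (normalCone_le_nhds n c) hKb]
    with ζ h1 h2 h3
  have hηy : 0 < η * ζ.2.im := mul_pos hη0 h2.1
  refine ⟨h1 _ (by rwa [dist_self]), ?_⟩
  -- A boundary point closer than ηy would lie in D, which is open.
  have hinf : η * ζ.2.im ≤ Metric.infDist (φ.symm ζ) (frontier D) := by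
    rw [Metric.le_infDist ⟨p, hp⟩]
    intro Q hQ
    by_contra! hlt
    rw [dist_comm] at hlt
    have := h1 Q hlt
    rw [hD.frontier_eq] at hQ
    exact hQ.2 this
  calc dist (φ.symm ζ) p ≤ K * ‖ζ‖ := by rw [dist_eq_norm]; exact h3
    _ ≤ K * (c * ζ.2.im) := by gcongr; exact h2.2
    _ = K * c / η * (η * ζ.2.im) := by field_simp
    _ ≤ _ := by gcongr

/-- The sequential definition of the non-tangential differential in terms of filters. -/
theorem IsNontangentialDifferential.isLittleO {n : ℕ} {D : Set (AmbientSpace n)}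
    {p p' : AmbientSpace n} {F : AmbientSpace n → AmbientSpace n}
    {L : AmbientSpace n →ₗ[ℝ] AmbientSpace n} (h : IsNontangentialDifferential D p p' F L) (c : ℝ) :
    (fun Z => F Z - p' - L (Z - p)) =o[𝓝[{Z | Z ∈ D ∧
      dist Z p ≤ c * Metric.infDist Z (frontier D)}] p] (fun Z => Z - p) := by
  rw [Asymptotics.isLittleO_iff]
  intro ε hε
  by_contra hcon
  obtain ⟨Z, hZ, hZn⟩ := exists_seq_forall_of_frequently (not_eventually.1 hcon)
  obtain ⟨hZp, hZm⟩ := tendsto_nhdsWithin_iff.1 hZ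
  obtain ⟨k₀, hk₀⟩ := eventually_atTop.1 hZm
  have hseq : NontangentialSeq D p (fun k => Z (k + k₀)) :=
    ⟨fun k => (hk₀ _ (Nat.le_add_left _ _)).1, hZp.comp (tendsto_add_atTop_nat k₀),
      c, fun k => (hk₀ _ (Nat.le_add_left _ _)).2⟩
  obtain ⟨k, hk⟩ := ((h _ hseq).def hε).exists
  exact hZn _ hk

theorem eventually_normalCone_iff {n : ℕ} {c : ℝ} {P : CoordSpace n → Prop} :
    (∀ᶠ ζ in normalCone n c, P ζ) ↔
      ∃ δ > 0, ∀ ζ : CoordSpace n, ‖ζ‖ < δ → 0 < ζ.2.im → ‖ζ‖ ≤ c * ζ.2.im → P ζ := by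
  rw [normalCone, eventually_nhdsWithin_iff, Metric.eventually_nhds_iff_ball]
  constructor
  · rintro ⟨δ, hδ, h⟩
    exact ⟨δ, hδ, fun ζ h1 h2 h3 => h ζ (by simpa using h1) ⟨h2, h3⟩⟩
  · rintro ⟨δ, hδ, h⟩
    exact ⟨δ, hδ, fun ζ h1 h2 => h ζ (by simpa using h1) h2.1 h2.2⟩

theorem tendsto_smul_normalCone {n : ℕ} {ξ : CoordSpace n} {c : ℝ} (hξ : 0 < ξ.2.im)
    (hc : ‖ξ‖ ≤ c * ξ.2.im) :
    Tendsto (fun t : ℝ => (t : ℂ) • ξ) (𝓝[>] 0) (normalCone n c) := by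
  refine tendsto_nhdsWithin_iff.2 ⟨?_, ?_⟩
  · have : Continuous fun t : ℝ => (t : ℂ) • ξ := by fun_prop
    have h0 := this.tendsto 0
    simp only [Complex.ofReal_zero, zero_smul] at h0
    exact h0.mono_left nhdsWithin_le_nhds
  · filter_upwards [self_mem_nhdsWithin] with t ht
    have ht : 0 < t := ht
    have h1 : ((t : ℂ) • ξ).2.im = t * ξ.2.im := by simp
    refine ⟨by rw [h1]; positivity, ?_⟩
    rw [h1, norm_smul, Complex.norm_real, Real.norm_eq_abs, abs_of_pos ht]
    calc t * ‖ξ‖ ≤ t * (c * ξ.2.im) := by gcongr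
      _ = _ := by ring

/-! ### Complex linearity and the last component of the differential -/

section linearity

variable {n : ℕ} {G : CoordSpace n → CoordSpace n} {M : CoordSpace n →L[ℝ] CoordSpace n}

theorem tendsto_inv_smul_of_isLittleO
    (hG : ∀ c > 0, (fun ζ => G ζ - M ζ) =o[normalCone n c] fun ζ => ζ)
    {ξ : CoordSpace n} (hξ : 0 < ξ.2.im) :
    Tendsto (fun t : ℝ => t⁻¹ • G ((t : ℂ) • ξ)) (𝓝[>] 0) (𝓝 (M ξ)) := by
  have hξn : 0 < ‖ξ‖ := hξ.trans_le ((le_abs_self _).trans ξ.im_le_norm)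
  have h1 := (hG (‖ξ‖ / ξ.2.im) (by positivity)).comp_tendsto
    (tendsto_smul_normalCone hξ (by field_simp; rfl))
  rw [tendsto_iff_norm_sub_tendsto_zero]
  have h2 : (fun t : ℝ => G ((t : ℂ) • ξ) - M ((t : ℂ) • ξ)) =o[𝓝[>] (0 : ℝ)] fun t => t := by
    refine h1.trans_isBigO (Asymptotics.IsBigO.of_bound ‖ξ‖ (Eventually.of_forall fun t => ?_))
    simp [norm_smul, mul_comm]
  refine (tendsto_zero_iff_norm_tendsto_zero.1 h2.tendsto_inv_smul_nhds_zero).congr' ?_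
  filter_upwards [self_mem_nhdsWithin] with t ht
  have ht : t ≠ 0 := (show 0 < t from ht).ne'
  have h3 : M ((t : ℂ) • ξ) = t • M ξ := by
    rw [← map_smul, Complex.coe_smul]
  rw [h3, smul_sub, smul_smul, inv_mul_cancel₀ ht, one_smul]

/-- The differential of a holomorphic map along a cone is complex linear. -/
theorem map_I_smul_of_isLittleO
    (hG : ∀ c > 0, (fun ζ => G ζ - M ζ) =o[normalCone n c] fun ζ => ζ)
    (hd : ∀ c > 0, ∀ᶠ ζ in normalCone n c, DifferentiableAt ℂ G ζ) (ξ : CoordSpace n) :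
    M (Complex.I • ξ) = Complex.I • M ξ := by
  have main : ∀ ξ : CoordSpace n, 0 < ξ.2.im → M (Complex.I • ξ) = Complex.I • M ξ := by
    intro ξ hξ
    have hξn : 0 < ‖ξ‖ := hξ.trans_le ((le_abs_self _).trans ξ.im_le_norm)
    set y := ξ.2.im with hy
    -- For |τ - 1| < r the imaginary part of τw stays above y/2, so all the points tτξ lie in one
    -- cone.
    set r : ℝ := y / (2 * ‖ξ‖) with hr
    have hr0 : 0 < r := by positivity
    have hrξ : r * ‖ξ‖ = y / 2 := by rw [hr]; field_simp
    have hr1 : r ≤ 1 := by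
      rw [hr, div_le_one (by positivity)]
      linarith [(le_abs_self _).trans ξ.im_le_norm]
    set c : ℝ := 4 * ‖ξ‖ / y with hc
    have hc0 : 0 < c := by positivity
    have hcone : ∀ t : ℝ, 0 < t → ∀ τ ∈ Metric.ball (1 : ℂ) r,
        0 < (((t : ℂ) * τ) • ξ).2.im ∧
          ‖((t : ℂ) * τ) • ξ‖ ≤ c * (((t : ℂ) * τ) • ξ).2.im ∧
          ‖((t : ℂ) * τ) • ξ‖ ≤ 2 * ‖ξ‖ * t := by
      intro t ht τ hτ
      rw [Metric.mem_ball, dist_eq_norm] at hτ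
      have h1 : (((t : ℂ) * τ) • ξ).2.im = t * (τ • ξ).2.im := by
        simp [mul_assoc]
      have h2 : y / 2 ≤ (τ • ξ).2.im := by
        have h3 : (τ • ξ).2.im = y + ((τ - 1) • ξ).2.im := by simp [hy]; ring
        have h4 := ((τ - 1) • ξ).im_le_norm
        rw [norm_smul, abs_le] at h4
        have : ‖τ - 1‖ * ‖ξ‖ ≤ r * ‖ξ‖ := by gcongr
        linarith [h4.1]
      have h5 : ‖τ‖ ≤ 2 := by
        have := norm_add_le (τ - 1) 1
        rw [sub_add_cancel, norm_one] at this
        linarith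
      have h6 : ‖((t : ℂ) * τ) • ξ‖ ≤ 2 * ‖ξ‖ * t := by
        rw [norm_smul, norm_mul, Complex.norm_real, Real.norm_eq_abs, abs_of_pos ht]
        nlinarith [mul_le_mul_of_nonneg_left h5 (mul_pos ht hξn).le]
      refine ⟨by rw [h1]; exact mul_pos ht (by linarith), h6.trans ?_, h6⟩
      rw [h1]
      calc 2 * ‖ξ‖ * t = c * (t * (y / 2)) := by rw [hc]; field_simp; ring
        _ ≤ _ := by gcongr
    have hsmall : ∀ δ > 0, ∀ᶠ t in 𝓝[>] (0 : ℝ), 0 < t ∧ 2 * ‖ξ‖ * t < δ := by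
      intro δ hδ
      filter_upwards [Ioo_mem_nhdsGT (show 0 < δ / (2 * ‖ξ‖) by positivity)] with t ht
      refine ⟨ht.1, ?_⟩
      have := ht.2
      rw [lt_div_iff₀ (by positivity)] at this
      linarith
    -- A locally uniform limit of holomorphic functions: τ ↦ M(τξ) is holomorphic near 1. Its
    -- complex derivative there must agree with the real-linear map τ ↦ M(τξ).
    have hunif : TendstoUniformlyOn (fun (t : ℝ) (τ : ℂ) => (t : ℂ)⁻¹ • G (((t : ℂ) * τ) • ξ))
        (fun τ => M (τ • ξ)) (𝓝[>] 0) (Metric.ball 1 r) := by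
      rw [Metric.tendstoUniformlyOn_iff]
      intro ε hε
      obtain ⟨δ, hδ, hb⟩ := eventually_normalCone_iff.1
        ((hG c hc0).def (show 0 < ε / (4 * ‖ξ‖) by positivity))
      filter_upwards [hsmall δ hδ] with t ht τ hτ
      obtain ⟨h1, h2, h3⟩ := hcone t ht.1 τ hτ
      have h4 := hb _ (h3.trans_lt ht.2) h1 h2
      have ht0 : (t : ℂ) ≠ 0 := by exact_mod_cast ht.1.ne'
      have h5 : M (τ • ξ) = (t : ℂ)⁻¹ • M (((t : ℂ) * τ) • ξ) := by
        rw [mul_smul, Complex.coe_smul, M.map_smul t, ← Complex.coe_smul, smul_smul,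
          inv_mul_cancel₀ ht0, one_smul]
      rw [h5, dist_comm, dist_eq_norm, ← smul_sub, norm_smul, norm_inv, Complex.norm_real,
        Real.norm_eq_abs, abs_of_pos ht.1, inv_mul_lt_iff₀ ht.1]
      refine h4.trans_lt ?_
      calc ε / (4 * ‖ξ‖) * ‖((t : ℂ) * τ) • ξ‖ ≤ ε / (4 * ‖ξ‖) * (2 * ‖ξ‖ * t) := by gcongr
        _ = t * (ε / 2) := by field_simp; ring
        _ < t * ε := by
          have := ht.1
          gcongr
          linarith
    have hdiff : DifferentiableOn ℂ (fun τ : ℂ => M (τ • ξ)) (Metric.ball 1 r) := by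
      refine hunif.tendstoLocallyUniformlyOn.differentiableOn ?_ Metric.isOpen_ball
      obtain ⟨δ, hδ, hb⟩ := eventually_normalCone_iff.1 (hd c hc0)
      filter_upwards [hsmall δ hδ] with t ht τ hτ
      obtain ⟨h1, h2, h3⟩ := hcone t ht.1 τ hτ
      have h4 := hb _ (h3.trans_lt ht.2) h1 h2
      have h5 : DifferentiableAt ℂ (fun τ : ℂ => ((t : ℂ) * τ) • ξ) τ := by fun_prop
      have h6 := (DifferentiableAt.comp (g := G) τ h4 h5).const_smul (t : ℂ)⁻¹
      exact h6.differentiableWithinAt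
    have hd1 := (hdiff.differentiableAt (Metric.ball_mem_nhds 1 hr0)).hasFDerivAt
    have hd2 := hd1.restrictScalars ℝ
    have hd3 : HasFDerivAt (fun τ : ℂ => M (τ • ξ))
        (M.comp ((ContinuousLinearMap.toSpanSingleton ℂ ξ).restrictScalars ℝ)) 1 :=
      (M.comp ((ContinuousLinearMap.toSpanSingleton ℂ ξ).restrictScalars ℝ)).hasFDerivAt
    have heq := hd2.unique hd3
    have e1 := congrArg (fun T => T Complex.I) heq
    have e2 := congrArg (fun T => T 1) heq
    simp only [ContinuousLinearMap.coe_restrictScalars', ContinuousLinearMap.comp_apply,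
      ContinuousLinearMap.toSpanSingleton_apply, one_smul] at e1 e2
    rw [← e1, ← e2, ← map_smul, smul_eq_mul, mul_one]
  -- Every vector is a difference of two vectors with positive Im w.
  set s : ℝ := |ξ.2.im| + 1 with hs
  have hs0 : 0 < s := by positivity
  set e : CoordSpace n := (0, Complex.I * s) with he
  have h1 := main (ξ + e) (by simp [he]; linarith [neg_abs_le ξ.2.im])
  have h2 := main e (by simp [he]; exact hs0)
  have h3 : ξ = (ξ + e) - e := by abel
  rw [h3, smul_sub, map_sub, h1, h2, map_sub, smul_sub]

theorem map_smul_complex_of_isLittleO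
    (hG : ∀ c > 0, (fun ζ => G ζ - M ζ) =o[normalCone n c] fun ζ => ζ)
    (hd : ∀ c > 0, ∀ᶠ ζ in normalCone n c, DifferentiableAt ℂ G ζ) (a : ℂ) (ξ : CoordSpace n) :
    M (a • ξ) = a • M ξ := by
  conv_lhs => rw [← Complex.re_add_im a, add_smul, map_add, mul_smul, Complex.coe_smul,
    Complex.coe_smul, map_smul, map_smul, map_I_smul_of_isLittleO hG hd]
  conv_rhs => rw [← Complex.re_add_im a, add_smul, mul_smul, Complex.coe_smul, Complex.coe_smul]

/-- A complex linear functional with non-negative imaginary part on the half-space `Im w > 0` is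
a non-negative multiple of `w`. -/
theorem exists_real_eq_mul_of_im_nonneg {μ : CoordSpace n →ₗ[ℂ] ℂ}
    (h : ∀ ξ : CoordSpace n, 0 < ξ.2.im → 0 ≤ (μ ξ).im) :
    ∃ lam : ℝ, 0 ≤ lam ∧ ∀ ξ, μ ξ = lam * ξ.2 := by
  have hz : ∀ z, (μ (z, 0)).im = 0 := by
    intro z
    -- Adding multiples of (z, 0) does not change Im w, so Im μ(z, 0) cannot be nonzero; replacing z
    -- by iz then kills the real part.
    have key : ∀ s : ℝ, 0 ≤ s * (μ (z, 0)).im + (μ (0, Complex.I)).im := by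
      intro s
      have h1 := h ((s : ℂ) • (z, 0) + (0, Complex.I)) (by simp)
      rw [map_add, map_smul] at h1
      simpa using h1
    by_contra hne
    have h2 := key (-((μ (0, Complex.I)).im + 1) / (μ (z, 0)).im)
    rw [div_mul_cancel₀ _ hne] at h2
    linarith
  have hz0 : ∀ z, μ (z, 0) = 0 := by
    intro z
    have h1 := hz (Complex.I • z)
    have h2 : ((Complex.I • z, 0) : CoordSpace n) = Complex.I • (z, 0) := by simp
    rw [h2, map_smul] at h1
    apply Complex.ext
    · simpa using h1
    · exact hz z
  set b : ℂ := μ (0, 1) with hb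
  have hw : ∀ w : ℂ, μ (0, w) = w * b := by
    intro w
    have h2 : ((0, w) : CoordSpace n) = w • (0, 1) := by simp
    rw [h2, map_smul, smul_eq_mul]
  have hbre : 0 ≤ b.re := by
    have := h (0, Complex.I) (by simp)
    rw [hw] at this
    simpa using this
  -- Real translations of w do not change Im w either.
  have hbim : b.im = 0 := by
    by_contra hne
    have := h (0, ((-(b.re + 1) / b.im : ℝ) : ℂ) + Complex.I) (by simp)
    rw [hw] at this
    rw [Complex.mul_im] at this
    simp only [Complex.add_re, Complex.ofReal_re, Complex.I_re, add_zero, Complex.add_im,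
      Complex.ofReal_im, Complex.I_im, zero_add, one_mul, div_mul_cancel₀ _ hne] at this
    linarith
  refine ⟨b.re, hbre, fun ξ => ?_⟩
  have h3 : ξ = (ξ.1, 0) + (0, ξ.2) := by simp
  conv_lhs => rw [h3, map_add, hz0, hw, zero_add]
  have : b = (b.re : ℂ) := Complex.ext (by simp) (by simp [hbim])
  rw [← this, mul_comm]

end linearity

/-! ### The peak function -/

/-- The holomorphic function `w + i w²`, whose imaginary part is comparable to the distance to the
boundary plus the squared distance to the origin on strongly pseudoconvex domains in normal form. -/
noncomputable def peakFunction {n : ℕ} (ζ : CoordSpace n) : ℂ := ζ.2 + Complex.I * ζ.2 ^ 2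

theorem peakFunction_im {n : ℕ} (ζ : CoordSpace n) :
    (peakFunction ζ).im = ζ.2.im + ζ.2.re ^ 2 - ζ.2.im ^ 2 := by
  simp [peakFunction, pow_two]; ring

theorem differentiable_peakFunction {n : ℕ} :
    Differentiable ℂ (peakFunction : CoordSpace n → ℂ) := by
  unfold peakFunction; fun_prop

/-- In the application N = ‖z‖², w = x + iy and e = M‖ζ‖, so the remainder is e times a squared
norm. Its Re w part is paid for by the x² coming from i w², its z part by the slack 1 - a, and y² is
absorbed by |y|. -/
theorem peak_inequality {a N x y s e : ℝ} (ha : 0 ≤ a) (ha1 : a < 1) (hN : 0 ≤ N) (hs : 0 ≤ s)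
    (hys : |y| ≤ s) (hsm : s ≤ (1 - a) / 16) (hem : e ≤ (1 - a) / 16)
    (h : N - e * (N + x ^ 2 + y ^ 2) < y) :
    a * N + (1 - a) / 4 * (N + x ^ 2 + y ^ 2) ≤ y + x ^ 2 - y ^ 2 := by
  set m := (1 - a) / 16 with hm
  have hm0 : 0 < m := by rw [hm]; linarith
  have hm1 : m ≤ 1 / 16 := by rw [hm]; linarith
  have ha' : a = 1 - 16 * m := by rw [hm]; ring
  have hx := sq_nonneg x
  have hyy := sq_nonneg y
  have h1 : N - m * (N + x ^ 2 + y ^ 2) < y := by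
    have : e * (N + x ^ 2 + y ^ 2) ≤ m * (N + x ^ 2 + y ^ 2) := by gcongr
    linarith
  have h2 : y ^ 2 ≤ m * |y| := by
    rw [← sq_abs, pow_two]
    exact mul_le_mul_of_nonneg_right (hys.trans hsm) (abs_nonneg y)
  have h3 : (1 - a) / 4 = 4 * m := by rw [hm]; ring
  rw [h3, ha']
  have h4 : m * y ^ 2 ≤ 1 / 16 * y ^ 2 := by gcongr
  have h5 : m * x ^ 2 ≤ 1 / 16 * x ^ 2 := by gcongr
  have h6 : m * N ≤ 1 / 16 * N := by gcongr
  rcases le_or_gt 0 y with h0 | h0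
  · rw [abs_of_nonneg h0] at h2
    have h7 : m * y ≤ 1 / 16 * y := by gcongr
    have h8 : (1 - m) * N - m * x ^ 2 ≤ (1 + m) * y := by nlinarith
    have h9 : (1 - 3 * m) * ((1 - m) * N - m * x ^ 2) ≤ (1 - 3 * m) * ((1 + m) * y) := by
      gcongr
      linarith
    have h10 : 0 ≤ m * m * N := by positivity
    have h11 : 0 ≤ m * m * x ^ 2 := by positivity
    have h12 : 0 ≤ m * m * y := by positivity
    nlinarith
  · rw [abs_of_neg h0] at h2
    have h7 : m * (-y) ≤ 1 / 16 * (-y) := by gcongr; linarith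
    nlinarith

namespace IsNormalCoord

variable {n : ℕ} {D : Set (AmbientSpace n)} {p : AmbientSpace n}
  {φ : OpenPartialHomeomorph (AmbientSpace n) (CoordSpace n)}

/-- The second bound makes p a peak point, as `disc_localization` requires; the first, with a close
to 1, feeds the Schwarz lemma `sq_norm_deriv_le_im`. -/
theorem exists_peak (hφ : IsNormalCoord D p φ) {a : ℝ} (ha : 0 ≤ a) (ha1 : a < 1) :
    ∃ c > 0, ∀ᶠ Z in 𝓝 p, Z ∈ D → a * ‖(φ Z).1‖ ^ 2 ≤ (peakFunction (φ Z)).im ∧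
      c * ‖Z - p‖ ^ 2 ≤ (peakFunction (φ Z)).im := by
  obtain ⟨M, hM, hMD⟩ := hφ.exists_lt_im_of_mem
  obtain ⟨K, hK, hKb⟩ := (hφ.hasFDerivAt_symm.isBigO_sub).exists_pos
  have hKb := hφ.tendsto.eventually hKb.bound
  simp only [hφ.symm_zero, sub_zero] at hKb
  set m := (1 - a) / 16 with hm
  have hm0 : 0 < m := by rw [hm]; linarith
  refine ⟨(1 - a) / 4 / K ^ 2, by
    have : 0 < 1 - a := by linarith
    positivity, ?_⟩
  filter_upwards [hMD, hKb, hφ.tendsto (Metric.ball_mem_nhds 0 (lt_min hm0 (div_pos hm0 hM))),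
    φ.open_source.mem_nhds hφ.mem_source] with Z h1 h2 h3 h4 hZ
  have h1 := h1 hZ
  rw [φ.left_inv h4] at h2
  set ζ := φ Z with hζ
  rw [Set.mem_preimage, mem_ball_zero_iff, lt_min_iff] at h3
  have hsq : ‖ζ‖ ^ 2 ≤ ‖ζ.1‖ ^ 2 + ζ.2.re ^ 2 + ζ.2.im ^ 2 := by
    have e1 : ‖ζ.2‖ ^ 2 = ζ.2.re ^ 2 + ζ.2.im ^ 2 := by
      rw [Complex.sq_norm, Complex.normSq_apply]; ring
    rw [Prod.norm_def]
    rcases max_choice ‖ζ.1‖ ‖ζ.2‖ with h5 | h5 <;> rw [h5]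
    · nlinarith [sq_nonneg ζ.2.re, sq_nonneg ζ.2.im]
    · nlinarith [sq_nonneg ‖ζ.1‖]
  have he : M * ‖ζ‖ ≤ m := by
    have := h3.2
    rw [lt_div_iff₀ hM] at this
    linarith
  have h5 : ‖ζ.1‖ ^ 2 - M * ‖ζ‖ * (‖ζ.1‖ ^ 2 + ζ.2.re ^ 2 + ζ.2.im ^ 2) < ζ.2.im := by
    refine lt_of_le_of_lt ?_ h1
    have : M * ‖ζ‖ * ‖ζ‖ ^ 2 ≤ M * ‖ζ‖ * (‖ζ.1‖ ^ 2 + ζ.2.re ^ 2 + ζ.2.im ^ 2) := by gcongr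
    linarith [show M * ‖ζ‖ ^ 3 = M * ‖ζ‖ * ‖ζ‖ ^ 2 by ring]
  have h6 := peak_inequality ha ha1 (sq_nonneg ‖ζ.1‖) (norm_nonneg ζ)
    ζ.im_le_norm h3.1.le he h5
  rw [← peakFunction_im] at h6
  have h7 : 0 ≤ (1 - a) / 4 := by linarith
  constructor
  · have : 0 ≤ (1 - a) / 4 * (‖ζ.1‖ ^ 2 + ζ.2.re ^ 2 + ζ.2.im ^ 2) := by positivity
    linarith
  · have h8 : ‖Z - p‖ ^ 2 ≤ K ^ 2 * ‖ζ‖ ^ 2 := by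
      rw [← mul_pow]; gcongr
    have h9 : 0 ≤ a * ‖ζ.1‖ ^ 2 := by positivity
    calc (1 - a) / 4 / K ^ 2 * ‖Z - p‖ ^ 2 ≤ (1 - a) / 4 / K ^ 2 * (K ^ 2 * ‖ζ‖ ^ 2) := by gcongr
      _ = (1 - a) / 4 * ‖ζ‖ ^ 2 := by field_simp
      _ ≤ (1 - a) / 4 * (‖ζ.1‖ ^ 2 + ζ.2.re ^ 2 + ζ.2.im ^ 2) := by gcongr
      _ ≤ _ := by linarith

theorem exists_disc_localization (hφ : IsNormalCoord D p φ) (hD : IsOpen D) (hp : p ∈ frontier D)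
    {O : Set (AmbientSpace n)} (hO : O ∈ 𝓝 p) :
    ∃ K > 0, ∃ O₀ ∈ 𝓝 p, ∀ f : ℂ → AmbientSpace n, DifferentiableOn ℂ f (Metric.ball 0 1) →
      Set.MapsTo f (Metric.ball 0 1) D → f 0 ∈ O₀ →
        ∀ ζ : ℂ, ‖ζ‖ < 1 - K * ‖peakFunction (φ (f 0))‖ → f ζ ∈ O := by
  obtain ⟨c, hc, hpk⟩ := hφ.exists_peak le_rfl one_pos
  obtain ⟨V, hVs, hVo, hpV⟩ := mem_nhds_iff.1 (inter_mem hpk (φ.open_source.mem_nhds hφ.mem_source))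
  have hpD : p ∉ D := by rw [hD.frontier_eq] at hp; exact hp.2
  exact disc_localization (h := fun Z => peakFunction (φ Z)) hc hVo hpV hpD
    (differentiable_peakFunction.comp_differentiableOn
      (hφ.holomorphic.mono fun Z hZ => (hVs hZ).2))
    (by simp [hφ.map_base, peakFunction]) (fun Z hZ hZD => ((hVs hZ).1 hZD).2) hO

end IsNormalCoord

/-! ### Germs in coordinates -/

/-- The differential of a map between coordinate systems in normal form. -/
noncomputable def coordDifferential {n : ℕ} {D D' : Set (AmbientSpace n)} {p p' : AmbientSpace n}
    {φ φ' : OpenPartialHomeomorph (AmbientSpace n) (CoordSpace n)} (hφ : IsNormalCoord D p φ)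
    (hφ' : IsNormalCoord D' p' φ') (L : AmbientSpace n →ₗ[ℝ] AmbientSpace n) :
    CoordSpace n →L[ℝ] CoordSpace n :=
  ((hφ'.tangentEquiv : AmbientSpace n →L[ℂ] CoordSpace n).restrictScalars ℝ).comp
    ((LinearMap.toContinuousLinearMap L).comp
      ((hφ.tangentEquiv.symm : CoordSpace n →L[ℂ] AmbientSpace n).restrictScalars ℝ))

theorem coordDifferential_apply {n : ℕ} {D D' : Set (AmbientSpace n)} {p p' : AmbientSpace n}
    {φ φ' : OpenPartialHomeomorph (AmbientSpace n) (CoordSpace n)} (hφ : IsNormalCoord D p φ)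
    (hφ' : IsNormalCoord D' p' φ') (L : AmbientSpace n →ₗ[ℝ] AmbientSpace n) (ζ : CoordSpace n) :
    coordDifferential hφ hφ' L ζ = hφ'.tangentEquiv (L (hφ.tangentEquiv.symm ζ)) := rfl

theorem hasBlockForm_iff {n : ℕ} {D D' : Set (AmbientSpace n)} {p p' : AmbientSpace n}
    {φ φ' : OpenPartialHomeomorph (AmbientSpace n) (CoordSpace n)} (hφ : IsNormalCoord D p φ)
    (hφ' : IsNormalCoord D' p' φ') (L : AmbientSpace n →ₗ[ℝ] AmbientSpace n)
    (C : Matrix (Fin n) (Fin n) ℂ) (A : EuclideanSpace ℂ (Fin n)) (lam : ℝ) :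
    HasBlockForm φ φ' p p' L C A lam ↔ ∀ ζ : CoordSpace n, coordDifferential hφ hφ' L ζ =
      (Matrix.toEuclideanLin C ζ.1 + ζ.2 • A, (lam : ℂ) * ζ.2) := by
  constructor
  · intro h ζ
    have := h (hφ.tangentEquiv.symm ζ)
    rw [← hφ.tangentEquiv_apply, ← hφ'.tangentEquiv_apply,
      ContinuousLinearEquiv.apply_symm_apply] at this
    exact this
  · intro h v
    have := h (hφ.tangentEquiv v)
    rw [coordDifferential_apply, ContinuousLinearEquiv.symm_apply_apply] at this
    exact this

/-- A germ of holomorphic maps with a non-tangential differential, seen in coordinates. -/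
structure CoordGerm {n : ℕ} (D D' : Set (AmbientSpace n)) (p' : AmbientSpace n)
    (φ φ' : OpenPartialHomeomorph (AmbientSpace n) (CoordSpace n))
    (F : AmbientSpace n → AmbientSpace n) (M : CoordSpace n →L[ℝ] CoordSpace n) : Prop where
  exists_differentiableAt : ∃ U : Set (AmbientSpace n), IsOpen U ∧ φ.symm 0 ∈ U ∧
    (∀ Z ∈ U, Z ∈ D → DifferentiableAt ℂ F Z) ∧ ∀ Z ∈ U, Z ∈ D → F Z ∈ D'
  tendsto : ∀ c > 0, Tendsto (fun ζ => F (φ.symm ζ)) (normalCone n c) (𝓝 p')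
  isLittleO : ∀ c > 0, (fun ζ => φ' (F (φ.symm ζ)) - M ζ) =o[normalCone n c] fun ζ => ζ
  mem : ∀ c > 0, ∀ᶠ ζ in normalCone n c, φ.symm ζ ∈ D
  differentiableAt : ∀ c > 0, ∀ᶠ ζ in normalCone n c,
    DifferentiableAt ℂ (fun ζ => φ' (F (φ.symm ζ))) ζ

/-- The chain rule survives along cones: φ⁻¹ sends cones to non-tangential points, where F - p' is
O(ζ), so the error of linearizing φ' at p' is o(ζ). -/
theorem RepresentsGerm.coordGerm {n : ℕ} {D D' : Set (AmbientSpace n)} {p p' : AmbientSpace n}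
    {φ φ' : OpenPartialHomeomorph (AmbientSpace n) (CoordSpace n)} (hφ : IsNormalCoord D p φ)
    (hφ' : IsNormalCoord D' p' φ') (hD : IsOpen D) (hp : p ∈ frontier D)
    {F : AmbientSpace n → AmbientSpace n} {L : AmbientSpace n →ₗ[ℝ] AmbientSpace n}
    (hF : RepresentsGerm D D' p p' F) (hL : IsNontangentialDifferential D p p' F L) :
    CoordGerm D D' p' φ φ' F (coordDifferential hφ hφ' L) := by
  obtain ⟨U, hU, hpU, hFd, hFD, -⟩ := hF
  set Lc := LinearMap.toContinuousLinearMap L with hLc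
  have hsymm := hφ.hasFDerivAt_symm
  have hO1 : (fun ζ => φ.symm ζ - p) =O[𝓝 0] fun ζ : CoordSpace n => ζ := by
    simpa [hφ.symm_zero] using hsymm.isBigO_sub
  have hFd' : ∀ Z ∈ U, Z ∈ D → DifferentiableAt ℂ F Z := fun Z h1 h2 =>
    hFd.differentiableAt ((hU.inter hD).mem_nhds ⟨h1, h2⟩)
  have hmem : ∀ c > 0, ∀ᶠ ζ in normalCone n c, φ.symm ζ ∈ D := by
    intro c hc
    obtain ⟨c', hc'⟩ := hφ.tendsto_symm_normalCone hD hp hc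
    exact ((tendsto_nhdsWithin_iff.1 hc').2).mono fun ζ h => h.1
  have hlin : ∀ c > 0, (fun ζ => F (φ.symm ζ) - p' - Lc (hφ.tangentEquiv.symm ζ))
      =o[normalCone n c] fun ζ => ζ := by
    intro c hc
    obtain ⟨c', hc'⟩ := hφ.tendsto_symm_normalCone hD hp hc
    have h1 := ((hL.isLittleO c').comp_tendsto hc').trans_isBigO
      (hO1.mono (normalCone_le_nhds n c))
    have h2 : (fun ζ => φ.symm ζ - p - hφ.tangentEquiv.symm ζ)
        =o[normalCone n c] fun ζ : CoordSpace n => ζ := by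
      have := hsymm.isLittleO
      simp only [hφ.symm_zero, sub_zero] at this
      exact this.mono (normalCone_le_nhds n c)
    have h3 : (fun ζ => Lc (φ.symm ζ - p - hφ.tangentEquiv.symm ζ))
        =o[normalCone n c] fun ζ : CoordSpace n => ζ := (Lc.isBigO_comp _ _).trans_isLittleO h2
    refine (h1.add h3).congr_left fun ζ => ?_
    simp only [Function.comp, map_sub]
    have : ∀ v, L v = Lc v := fun v => rfl
    rw [this, this]
    abel
  have hbig : ∀ c > 0, (fun ζ => F (φ.symm ζ) - p') =O[normalCone n c]
      fun ζ : CoordSpace n => ζ := by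
    intro c hc
    have h1 : (fun ζ => Lc (hφ.tangentEquiv.symm ζ)) =O[normalCone n c]
        fun ζ : CoordSpace n => ζ := by
      refine (Lc.isBigO_comp _ _).trans ?_
      exact (hφ.tangentEquiv.symm : CoordSpace n →L[ℂ] AmbientSpace n).isBigO_id _
    refine ((hlin c hc).isBigO.add h1).congr_left fun ζ => by abel
  have htend : ∀ c > 0, Tendsto (fun ζ => F (φ.symm ζ)) (normalCone n c) (𝓝 p') := by
    intro c hc
    rw [← tendsto_sub_nhds_zero_iff]
    exact (hbig c hc).trans_tendsto (tendsto_id.mono_left (normalCone_le_nhds n c))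
  refine ⟨⟨U, hU, by rwa [hφ.symm_zero], hFd', fun Z h1 h2 => hFD ⟨h1, h2⟩⟩, htend, ?_, hmem, ?_⟩
  · intro c hc
    have h1 := hφ'.hasFDerivAt_coe.isLittleO.comp_tendsto (htend c hc)
    have h2 := h1.trans_isBigO (hbig c hc)
    have h3 : (fun ζ => hφ'.tangentEquiv (F (φ.symm ζ) - p' - Lc (hφ.tangentEquiv.symm ζ)))
        =o[normalCone n c] fun ζ : CoordSpace n => ζ :=
      ((hφ'.tangentEquiv : AmbientSpace n →L[ℂ] CoordSpace n).isBigO_comp _ _).trans_isLittleO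
        (hlin c hc)
    refine (h2.add h3).congr_left fun ζ => ?_
    have h4 : coordDifferential hφ hφ' L ζ = hφ'.tangentEquiv (Lc (hφ.tangentEquiv.symm ζ)) := rfl
    rw [h4]
    simp only [Function.comp, map_sub, hφ'.map_base, ContinuousLinearEquiv.coe_coe]
    abel
  · intro c hc
    filter_upwards [hmem c hc, (hφ.tendsto_symm.mono_left (normalCone_le_nhds n c))
      (hU.mem_nhds hpU), (normalCone_le_nhds n c)
        (φ.open_target.mem_nhds hφ.zero_mem_target),
      htend c hc (φ'.open_source.mem_nhds hφ'.mem_source)] with ζ h1 h2 h3 h4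
    exact DifferentiableAt.comp (g := φ') ζ
      (hφ'.holomorphic.differentiableAt (φ'.open_source.mem_nhds h4))
      (DifferentiableAt.comp (g := F) ζ (hFd' _ h2 h1)
        (hφ.holomorphic_symm.differentiableAt (φ.open_target.mem_nhds h3)))

/-! ### Test discs and the constraints they impose on the differential -/

/-- The inner normal vector `(0, i)`. -/
noncomputable def innerNormal (n : ℕ) : CoordSpace n := (0, Complex.I)

theorem innerNormal_im (n : ℕ) : (innerNormal n).2.im = 1 := by simp [innerNormal]

theorem Complex.norm_mobius_lt_one {b : ℝ} (hb0 : 0 ≤ b) (hb1 : b < 1) {ζ : ℂ} (hζ : ‖ζ‖ < 1) :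
    1 - b * ζ ≠ 0 ∧ ‖(ζ - b) / (1 - b * ζ)‖ < 1 := by
  have h0 : 1 - b * ζ ≠ 0 := by
    intro h
    have h1 : ‖(b : ℂ) * ζ‖ = 1 := by rw [← sub_eq_zero.1 h, norm_one]
    rw [norm_mul, Complex.norm_real, Real.norm_eq_abs, abs_of_nonneg hb0] at h1
    nlinarith [norm_nonneg ζ]
  refine ⟨h0, ?_⟩
  rw [norm_div, div_lt_one (norm_pos_iff.2 h0), ← sq_lt_sq₀ (norm_nonneg _) (norm_nonneg _),
    Complex.sq_norm, Complex.sq_norm, Complex.normSq_apply, Complex.normSq_apply]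
  have h1 : ζ.re * ζ.re + ζ.im * ζ.im < 1 := by
    rw [← Complex.normSq_apply, ← Complex.sq_norm]
    nlinarith [norm_nonneg ζ]
  simp
  nlinarith [mul_pos (show 0 < 1 - b ^ 2 by nlinarith) (sub_pos.2 h1)]

theorem deriv_fst_comp_mul {E : Type*} [NormedAddCommGroup E] [NormedSpace ℂ E] {g : ℂ → E × ℂ}
    (hg : DifferentiableAt ℂ g 0) (κ : ℂ) :
    deriv (fun ζ => (g (ζ * κ)).1) 0 = κ • (deriv g 0).1 := by
  have h1 : HasDerivAt (fun ζ : ℂ => ζ * κ) κ 0 := by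
    simpa using (hasDerivAt_id (0 : ℂ)).mul_const κ
  have h2 : HasDerivAt g (deriv g 0) ((fun ζ : ℂ => ζ * κ) 0) := by
    simpa using hg.hasDerivAt
  have h3 := HasDerivAt.scomp (0 : ℂ) h2 h1
  exact ((ContinuousLinearMap.fst ℂ E ℂ).hasFDerivAt.comp_hasDerivAt (0 : ℂ) h3).deriv

/-- The disc ζ ↦ (skζv, i s²) has ‖z‖² ≤ k² Im w. The factor k < 1 leaves a margin of order s²
against the cubic remainder of order s³. -/
theorem norm_parabolicDisc_le {n : ℕ} {v : EuclideanSpace ℂ (Fin n)} {s k : ℝ} (hs0 : 0 ≤ s)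
    (hs1 : s ≤ 1) (hk0 : 0 ≤ k) (hk1 : k ≤ 1) (hv : ‖v‖ ≤ 1) {ζ : ℂ} (hζ : ‖ζ‖ ≤ 1) :
    ‖(ζ * ((s * k : ℝ) : ℂ)) • ((v, 0) : CoordSpace n) + ((s ^ 2 : ℝ) : ℂ) • innerNormal n‖ ≤ s ∧
    ‖((ζ * ((s * k : ℝ) : ℂ)) • ((v, 0) : CoordSpace n) +
      ((s ^ 2 : ℝ) : ℂ) • innerNormal n).1‖ ≤ s * k ∧
    ((ζ * ((s * k : ℝ) : ℂ)) • ((v, 0) : CoordSpace n) +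
      ((s ^ 2 : ℝ) : ℂ) • innerNormal n).2.im = s ^ 2 := by
  have h1 : ‖((ζ * ((s * k : ℝ) : ℂ)) • ((v, 0) : CoordSpace n) +
      ((s ^ 2 : ℝ) : ℂ) • innerNormal n).1‖ ≤ s * k := by
    simp only [innerNormal, Prod.fst_add, Prod.smul_fst, smul_zero, add_zero, norm_smul,
      norm_mul, Complex.norm_real, Real.norm_eq_abs]
    rw [abs_of_nonneg hs0, abs_of_nonneg hk0]
    calc ‖ζ‖ * (s * k) * ‖v‖ ≤ 1 * (s * k) * 1 := by gcongr
      _ = s * k := by ring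
  have h2 : ((ζ * ((s * k : ℝ) : ℂ)) • ((v, 0) : CoordSpace n) +
      ((s ^ 2 : ℝ) : ℂ) • innerNormal n).2 = ((s ^ 2 : ℝ) : ℂ) * Complex.I := by
    simp [innerNormal]
  refine ⟨?_, h1, ?_⟩
  · rw [Prod.norm_def]
    refine max_le (h1.trans (by nlinarith)) ?_
    rw [h2, norm_mul, Complex.norm_I, Complex.norm_real, Real.norm_eq_abs,
      abs_of_nonneg (sq_nonneg s)]
    nlinarith
  · rw [h2, Complex.im_ofReal_mul, Complex.I_im, mul_one]

namespace CoordGerm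

variable {n : ℕ} {D D' : Set (AmbientSpace n)} {p p' : AmbientSpace n}
  {φ φ' : OpenPartialHomeomorph (AmbientSpace n) (CoordSpace n)}
  {F : AmbientSpace n → AmbientSpace n} {M : CoordSpace n →L[ℝ] CoordSpace n}

theorem eventually_mem_target (hg : CoordGerm D D' p' φ φ' F M) (hφ : IsNormalCoord D p φ)
    {c : ℝ} (hc : 0 < c) : ∀ᶠ ζ in normalCone n c, F (φ.symm ζ) ∈ D' := by
  obtain ⟨U, hU, hpU, -, hUD⟩ := hg.exists_differentiableAt
  rw [hφ.symm_zero] at hpU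
  filter_upwards [hg.mem c hc, (hφ.tendsto_symm.mono_left (normalCone_le_nhds n c))
    (hU.mem_nhds hpU)] with ζ h1 h2
  exact hUD _ h2 h1

theorem map_smul_complex (hg : CoordGerm D D' p' φ φ' F M) (a : ℂ) (ξ : CoordSpace n) :
    M (a • ξ) = a • M ξ :=
  map_smul_complex_of_isLittleO hg.isLittleO hg.differentiableAt a ξ

/-- Image points satisfy Im w' > -K‖·‖³; after division by t the right-hand side tends to 0 along
the ray tξ. -/
theorem im_nonneg (hg : CoordGerm D D' p' φ φ' F M) (hφ : IsNormalCoord D p φ)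
    (hφ' : IsNormalCoord D' p' φ') {ξ : CoordSpace n} (hξ : 0 < ξ.2.im) : 0 ≤ (M ξ).2.im := by
  obtain ⟨K, hK, hKD⟩ := hφ'.exists_lt_im_of_mem
  have hξn : 0 < ‖ξ‖ := hξ.trans_le ((le_abs_self _).trans ξ.im_le_norm)
  have hc : 0 < ‖ξ‖ / ξ.2.im := by positivity
  have hcone := tendsto_smul_normalCone (c := ‖ξ‖ / ξ.2.im) hξ (by field_simp; rfl)
  have hlim := tendsto_inv_smul_of_isLittleO hg.isLittleO hξ
  set g : ℝ → CoordSpace n := fun t => t⁻¹ • φ' (F (φ.symm ((t : ℂ) • ξ))) with hgdef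
  have h1 : Tendsto (fun t => (g t).2.im + K * t ^ 2 * ‖g t‖ ^ 3) (𝓝[>] 0)
      (𝓝 ((M ξ).2.im + K * 0 ^ 2 * ‖M ξ‖ ^ 3)) := by
    have ht : Tendsto (fun t : ℝ => t) (𝓝[>] 0) (𝓝 0) := tendsto_id.mono_left nhdsWithin_le_nhds
    exact ((Complex.continuous_im.comp continuous_snd).continuousAt.tendsto.comp hlim).add
      ((tendsto_const_nhds.mul (ht.pow 2)).mul (hlim.norm.pow 3))
  simp only [ne_eq, OfNat.ofNat_ne_zero, not_false_eq_true, zero_pow, mul_zero, zero_mul,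
    add_zero] at h1
  refine ge_of_tendsto h1 ?_
  filter_upwards [self_mem_nhdsWithin, hcone.eventually (hg.eventually_mem_target hφ hc),
    ((hg.tendsto _ hc).comp hcone).eventually hKD] with t ht h2 h3
  have ht : 0 < t := ht
  have h4 := h3 h2
  set Y := φ' (F (φ.symm ((t : ℂ) • ξ))) with hY
  have h5 : ‖Y.1‖ ^ 2 - K * ‖Y‖ ^ 3 < Y.2.im := h4
  have h6 : (g t).2.im = t⁻¹ * Y.2.im := by
    rw [show g t = t⁻¹ • Y from rfl]
    simp
  have h7 : ‖g t‖ = t⁻¹ * ‖Y‖ := by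
    rw [hgdef, norm_smul, Real.norm_eq_abs, abs_of_pos (by positivity)]
  rw [h6, h7]
  have h8 : t⁻¹ * Y.2.im + K * t ^ 2 * (t⁻¹ * ‖Y‖) ^ 3 = t⁻¹ * (Y.2.im + K * ‖Y‖ ^ 3) := by
    field_simp
  rw [h8]
  have : 0 ≤ Y.2.im + K * ‖Y‖ ^ 3 := by nlinarith [sq_nonneg ‖Y.1‖]
  positivity

theorem exists_block (hg : CoordGerm D D' p' φ φ' F M) (hφ : IsNormalCoord D p φ)
    (hφ' : IsNormalCoord D' p' φ') :
    ∃ (C : Matrix (Fin n) (Fin n) ℂ) (A : EuclideanSpace ℂ (Fin n)) (lam : ℝ), 0 ≤ lam ∧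
      ∀ ζ : CoordSpace n, M ζ = (Matrix.toEuclideanLin C ζ.1 + ζ.2 • A, (lam : ℂ) * ζ.2) := by
  set Mc : CoordSpace n →ₗ[ℂ] CoordSpace n :=
    { toFun := M, map_add' := map_add M, map_smul' := hg.map_smul_complex } with hMc
  obtain ⟨lam, hlam, hl⟩ := exists_real_eq_mul_of_im_nonneg
    (μ := (LinearMap.snd ℂ _ _).comp Mc) (fun ξ hξ => hg.im_nonneg hφ hφ' hξ)
  refine ⟨Matrix.toEuclideanLin.symm
    (((LinearMap.fst ℂ _ _).comp Mc).comp (LinearMap.inl ℂ _ _)), (M (0, 1)).1, lam, hlam,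
    fun ζ => Prod.ext ?_ (hl ζ)⟩
  rw [LinearEquiv.apply_symm_apply]
  have h1 : ζ = (ζ.1, 0) + ζ.2 • (0, 1) := by simp
  conv_lhs => rw [h1, map_add, hg.map_smul_complex]
  rfl

theorem exists_disc (hg : CoordGerm D D' p' φ φ' F M) (hφ : IsNormalCoord D p φ) :
    ∃ δ > 0, ∃ K > 0, ∀ γ : ℂ → CoordSpace n, DifferentiableOn ℂ γ (Metric.ball 0 1) →
      (∀ ζ ∈ Metric.ball (0 : ℂ) 1, ‖γ ζ‖ < δ ∧ ‖(γ ζ).1‖ ^ 2 + K * ‖γ ζ‖ ^ 3 < (γ ζ).2.im) →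
      DifferentiableOn ℂ (fun ζ => F (φ.symm (γ ζ))) (Metric.ball 0 1) ∧
        Set.MapsTo (fun ζ => F (φ.symm (γ ζ))) (Metric.ball 0 1) D' := by
  obtain ⟨U, hU, hpU, hUd, hUD⟩ := hg.exists_differentiableAt
  rw [hφ.symm_zero] at hpU
  obtain ⟨K, hK, hKD⟩ := hφ.exists_mem_of_lt_im
  obtain ⟨δ, hδ, hb⟩ := Metric.mem_nhds_iff.1 (inter_mem hKD (inter_mem
    (hφ.tendsto_symm (hU.mem_nhds hpU)) (φ.open_target.mem_nhds hφ.zero_mem_target)))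
  refine ⟨δ, hδ, K, hK, fun γ hγ h => ⟨fun ζ hζ => ?_, fun ζ hζ => ?_⟩⟩
  · obtain ⟨h1, h2⟩ := h ζ hζ
    obtain ⟨h3, h4, h5⟩ := hb (mem_ball_zero_iff.2 h1)
    exact (DifferentiableAt.comp (g := F) ζ (hUd _ h4 (h3 h2)) (DifferentiableAt.comp (g := φ.symm)
      ζ (hφ.holomorphic_symm.differentiableAt (φ.open_target.mem_nhds h5))
      (hγ.differentiableAt (Metric.isOpen_ball.mem_nhds hζ)))).differentiableWithinAt
  · obtain ⟨h1, h2⟩ := h ζ hζ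
    obtain ⟨h3, h4, h5⟩ := hb (mem_ball_zero_iff.2 h1)
    exact hUD _ h4 (h3 h2)

/-- The quadratic term of the peak function is O(t²) along the inner normal, so only the linear term
survives. -/
theorem tendsto_inv_smul_peakFunction (hg : CoordGerm D D' p' φ φ' F M) :
    Tendsto (fun t : ℝ => (t : ℂ)⁻¹ * peakFunction (φ' (F (φ.symm ((t : ℂ) • innerNormal n)))))
      (𝓝[>] 0) (𝓝 (M (innerNormal n)).2) := by
  have hlim := tendsto_inv_smul_of_isLittleO hg.isLittleO
    (show 0 < (innerNormal n).2.im by rw [innerNormal_im]; exact one_pos)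
  have h2 := (continuous_snd.tendsto _).comp hlim
  have ht : Tendsto (fun t : ℝ => (t : ℂ)) (𝓝[>] 0) (𝓝 0) := by
    have := Complex.continuous_ofReal.tendsto 0
    rw [Complex.ofReal_zero] at this
    exact this.mono_left nhdsWithin_le_nhds
  have h3 := h2.add ((ht.const_mul Complex.I).mul (h2.pow 2))
  simp only [mul_zero, zero_mul, add_zero] at h3
  refine h3.congr' ?_
  filter_upwards [self_mem_nhdsWithin] with t ht
  have ht : (t : ℂ) ≠ 0 := by exact_mod_cast (show 0 < t from ht).ne'
  simp only [Function.comp, Prod.smul_snd, peakFunction, Complex.real_smul, Complex.ofReal_inv]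
  field_simp

/-- A Hopf lemma. Otherwise the peak function at the image of t·(0, i) is o(t), so a disc in D'
centred there stays near p' except in a collar of width o(t). But a disc in the complex normal
direction reaches a fixed interior point Q at distance t/ρ from the unit circle. -/
theorem normal_ne_zero (hg : CoordGerm D D' p' φ φ' F M) (hφ : IsNormalCoord D p φ)
    (hφ' : IsNormalCoord D' p' φ') (hD' : IsOpen D') (hp' : p' ∈ frontier D') :
    (M (innerNormal n)).2 ≠ 0 := by
  intro h0
  obtain ⟨δ, hδ, K, hK, hdisc⟩ := hg.exists_disc hφ
  set ρ : ℝ := min (δ / 4) (min 1 (1 / (8 * K))) with hρ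
  have hρ0 : 0 < ρ := by positivity
  have hρδ : ρ ≤ δ / 4 := min_le_left _ _
  have hρ1 : ρ ≤ 1 := (min_le_right _ _).trans (min_le_left _ _)
  have hρK : K * ρ ≤ 1 / 8 := by
    have : ρ ≤ 1 / (8 * K) := (min_le_right _ _).trans (min_le_right _ _)
    calc K * ρ ≤ K * (1 / (8 * K)) := by gcongr
      _ = 1 / 8 := by field_simp
  set Q : AmbientSpace n := F (φ.symm (0, Complex.I * ρ)) with hQ
  -- The disc of radius ρ about iρ is tangent to the real axis at 0: |1 + u|² < 2(1 + Re u) bounds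
  -- the cubic remainder by a fraction of the height.
  have hcent : ∀ u : ℂ, ‖u‖ < 1 → ‖((0, Complex.I * ρ * (1 + u)) : CoordSpace n)‖ < δ ∧
      ‖((0, Complex.I * ρ * (1 + u)) : CoordSpace n).1‖ ^ 2 +
        K * ‖((0, Complex.I * ρ * (1 + u)) : CoordSpace n)‖ ^ 3 <
        ((0, Complex.I * ρ * (1 + u)) : CoordSpace n).2.im := by
    intro u hu
    have h1 : ‖((0, Complex.I * ρ * (1 + u)) : CoordSpace n)‖ = ρ * ‖1 + u‖ := by
      rw [Prod.norm_def]
      simp [abs_of_pos hρ0]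
      positivity
    have h2 : ‖1 + u‖ < 2 := by
      have := norm_add_le 1 u
      rw [norm_one] at this
      linarith
    have h3 : ‖1 + u‖ ^ 2 < 2 * (1 + u.re) := by
      have h4 : u.re * u.re + u.im * u.im < 1 := by
        rw [← Complex.normSq_apply, ← Complex.sq_norm]
        nlinarith [norm_nonneg u]
      rw [Complex.sq_norm, Complex.normSq_apply]
      simp
      nlinarith
    have him : ((0, Complex.I * ρ * (1 + u)) : CoordSpace n).2.im = ρ * (1 + u.re) := by
      simp
    rw [h1, him]
    refine ⟨by nlinarith, ?_⟩
    simp only [norm_zero, ne_eq, OfNat.ofNat_ne_zero, not_false_eq_true, zero_pow, zero_add]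
    have h5 : 0 ≤ ‖1 + u‖ := norm_nonneg _
    have h6 : K * (ρ * ‖1 + u‖) ^ 3 = (K * ρ) * ρ * (ρ * (‖1 + u‖ * ‖1 + u‖ ^ 2)) := by ring
    rw [h6]
    have h7 : 0 < 1 + u.re := by nlinarith [sq_nonneg ‖1 + u‖]
    have h8 : ‖1 + u‖ * ‖1 + u‖ ^ 2 ≤ 2 * (2 * (1 + u.re)) := by
      gcongr
    calc (K * ρ) * ρ * (ρ * (‖1 + u‖ * ‖1 + u‖ ^ 2))
        ≤ (1 / 8) * 1 * (ρ * (2 * (2 * (1 + u.re)))) := by gcongr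
      _ < ρ * (1 + u.re) := by nlinarith [mul_pos hρ0 h7]
  have hQD : Q ∈ D' := by
    have h1 := (hdisc (fun u => (0, Complex.I * ρ * (1 + u))) (by fun_prop)
      (fun u hu => hcent u (by simpa using hu))).2 (Metric.mem_ball_self one_pos)
    simpa using h1
  have hpD : p' ∉ D' := by rw [hD'.frontier_eq] at hp'; exact hp'.2
  have hO : {Q}ᶜ ∈ 𝓝 p' := isOpen_compl_singleton.mem_nhds (by
    rintro rfl
    exact hpD hQD)
  obtain ⟨K', hK', O₀, hO₀, hloc⟩ := hφ'.exists_disc_localization hD' hp' hO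
  have hlim := hg.tendsto_inv_smul_peakFunction.norm
  rw [h0, norm_zero] at hlim
  have hcone := tendsto_smul_normalCone (ξ := innerNormal n) (c := 1)
    (by rw [innerNormal_im]; exact one_pos)
    (by rw [innerNormal_im]; simp [innerNormal, Prod.norm_def])
  have hIoo : ∀ᶠ t in 𝓝[>] (0 : ℝ), t ∈ Set.Ioo 0 ρ := Ioo_mem_nhdsGT hρ0
  obtain ⟨t, ⟨ht0, htρ⟩, h1, h2⟩ := (hIoo.and
    ((hlim.eventually (gt_mem_nhds (show 0 < 1 / (K' * ρ) by positivity))).and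
      (((hg.tendsto 1 one_pos).comp hcone).eventually hO₀))).exists
  -- The Möbius map (ζ - b)/(1 - bζ) moves the centre of the disc to height t and takes ζ = b to the
  -- point whose image is Q.
  set b : ℝ := 1 - t / ρ with hb
  have htρ' : t / ρ < 1 := by rwa [div_lt_one hρ0]
  have htρ0 : 0 < t / ρ := by positivity
  have hb0 : 0 ≤ b := by rw [hb]; linarith
  have hb1 : b < 1 := by rw [hb]; linarith
  obtain ⟨hfd, hfD⟩ := hdisc (fun ζ => (0, Complex.I * ρ * (1 + (ζ - b) / (1 - b * ζ)))) (by
      intro ζ hζ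
      have := (Complex.norm_mobius_lt_one hb0 hb1 (mem_ball_zero_iff.1 hζ)).1
      apply DifferentiableAt.differentiableWithinAt
      fun_prop (disch := assumption)) (fun ζ hζ => hcent _
        (Complex.norm_mobius_lt_one hb0 hb1 (mem_ball_zero_iff.1 hζ)).2)
  have hf0 : ((0, Complex.I * ρ * (1 + (0 - (b : ℂ)) / (1 - b * 0))) : CoordSpace n) =
      (t : ℂ) • innerNormal n := by
    have hρc : (ρ : ℂ) ≠ 0 := by exact_mod_cast hρ0.ne'
    simp only [innerNormal, Prod.smul_mk, smul_zero, smul_eq_mul, Prod.mk.injEq, true_and,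
      mul_zero, sub_zero, div_one, zero_sub, hb]
    push_cast
    field_simp
    ring
  have h3 := hloc _ hfd hfD (by rw [hf0]; exact h2) b (by
    rw [hf0, Complex.norm_real, Real.norm_eq_abs, abs_of_nonneg hb0, hb]
    rw [norm_mul, norm_inv, Complex.norm_real, Real.norm_eq_abs, abs_of_pos ht0,
      inv_mul_lt_iff₀ ht0] at h1
    have h4 : K' * ‖peakFunction (φ' (F (φ.symm ((t : ℂ) • innerNormal n))))‖ < t / ρ := by
      calc _ < K' * (t * (1 / (K' * ρ))) := by gcongr
        _ = t / ρ := by field_simp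
    linarith)
  apply h3
  simp [hQ]

/-- A Cauchy estimate on the disc |τ| ≤ t. In the sup norm this disc stays in the cone ‖ζ‖ ≤ Im w,
where G - M is o(t), so the derivative of the error is o(t)/t. -/
theorem tendsto_deriv (hg : CoordGerm D D' p' φ φ' F M) {v : EuclideanSpace ℂ (Fin n)}
    (hv : ‖v‖ ≤ 1) :
    Tendsto (fun t : ℝ => deriv (fun τ : ℂ => φ' (F (φ.symm (τ • (v, 0) +
      (t : ℂ) • innerNormal n)))) 0) (𝓝[>] 0) (𝓝 (M (v, 0))) := by
  rw [Metric.tendsto_nhds]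
  intro ε hε
  obtain ⟨δ, hδ, hb⟩ := eventually_normalCone_iff.1
    (((hg.isLittleO 1 one_pos).def (half_pos hε)).and (hg.differentiableAt 1 one_pos))
  filter_upwards [Ioo_mem_nhdsGT hδ] with t ht
  obtain ⟨ht0, htδ⟩ := ht
  have hpt : ∀ τ ∈ Metric.closedBall (0 : ℂ) t,
      ‖τ • ((v, 0) : CoordSpace n) + (t : ℂ) • innerNormal n‖ ≤ t ∧
      (τ • ((v, 0) : CoordSpace n) + (t : ℂ) • innerNormal n).2.im = t := by
    intro τ hτ
    have hτ : ‖τ‖ ≤ t := by simpa using hτ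
    constructor
    · rw [Prod.norm_def]
      refine max_le ?_ ?_
      · simp only [innerNormal, Prod.fst_add, Prod.smul_fst, smul_zero, add_zero, norm_smul]
        calc ‖τ‖ * ‖v‖ ≤ t * 1 := by gcongr
          _ = t := mul_one t
      · simp [innerNormal, abs_of_pos ht0]
    · simp [innerNormal]
  have hpt2 : ∀ τ ∈ Metric.closedBall (0 : ℂ) t, _ := fun τ hτ =>
    hb (τ • ((v, 0) : CoordSpace n) + (t : ℂ) • innerNormal n) ((hpt τ hτ).1.trans_lt htδ)
      (by rw [(hpt τ hτ).2]; exact ht0) (by rw [(hpt τ hτ).2, one_mul]; exact (hpt τ hτ).1)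
  set g : ℂ → CoordSpace n := fun τ => φ' (F (φ.symm (τ • (v, 0) + (t : ℂ) • innerNormal n)))
    with hgdef
  have hgd : ∀ τ ∈ Metric.closedBall (0 : ℂ) t, DifferentiableAt ℂ g τ := fun τ hτ =>
    DifferentiableAt.comp (g := fun ζ => φ' (F (φ.symm ζ))) τ (hpt2 τ hτ).2 (by fun_prop)
  set B : CoordSpace n := M ((t : ℂ) • innerNormal n) with hB
  have hMe : ∀ τ : ℂ, M (τ • (v, 0) + (t : ℂ) • innerNormal n) = τ • M (v, 0) + B := fun τ => by
    rw [map_add, hg.map_smul_complex]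
  have hlin : ∀ τ : ℂ, HasDerivAt (fun τ : ℂ => τ • M (v, 0) + B) (M (v, 0)) τ := fun τ => by
    have := ((hasDerivAt_id τ).smul_const (M (v, 0))).add_const B
    rwa [one_smul] at this
  have hE : HasDerivAt (fun τ => g τ - (τ • M (v, 0) + B)) (deriv g 0 - M (v, 0)) 0 :=
    (hgd 0 (by simpa using ht0.le)).hasDerivAt.sub (hlin 0)
  have hbound : ‖deriv (fun τ => g τ - (τ • M (v, 0) + B)) 0‖ ≤ (ε / 2 * t) / t := by
    refine Complex.norm_deriv_le_of_forall_mem_sphere_norm_le ht0 ?_ ?_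
    · apply DifferentiableOn.diffContOnCl
      rw [closure_ball _ ht0.ne']
      exact fun τ hτ => ((hgd τ hτ).sub (hlin τ).differentiableAt).differentiableWithinAt
    · intro τ hτ
      have hτ' := Metric.sphere_subset_closedBall hτ
      have h1 := (hpt2 τ hτ').1
      rw [hMe] at h1
      exact h1.trans (by gcongr; exact (hpt τ hτ').1)
  rw [hE.deriv, mul_div_cancel_right₀ _ ht0.ne'] at hbound
  rw [dist_eq_norm]
  linarith

/-- The Schwarz lemma is applied to the images of the parabolic discs with s = √t. The peak function
at the image of the centre is tM(0, i)₂ + o(t), and the centre derivative carries the factor (sk)² =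
tk² after squaring, so t cancels in the limit. -/
theorem mul_sq_norm_le (hg : CoordGerm D D' p' φ φ' F M) (hφ : IsNormalCoord D p φ)
    (hφ' : IsNormalCoord D' p' φ') (hD' : IsOpen D') (hp' : p' ∈ frontier D')
    {v : EuclideanSpace ℂ (Fin n)} (hv : ‖v‖ ≤ 1) {k : ℝ} (hk0 : 0 < k) (hk1 : k < 1) :
    k ^ 5 * ‖(M (v, 0)).1‖ ^ 2 ≤ (M (innerNormal n)).2.im := by
  obtain ⟨δ, hδ, K, hK, hdisc⟩ := hg.exists_disc hφ
  obtain ⟨c, -, hpk⟩ := hφ'.exists_peak hk0.le hk1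
  obtain ⟨K', hK', O₀, hO₀, hloc⟩ := hφ'.exists_disc_localization hD' hp'
    (inter_mem hpk (φ'.open_source.mem_nhds hφ'.mem_source))
  have hcone := tendsto_smul_normalCone (ξ := innerNormal n) (c := 1)
    (by rw [innerNormal_im]; exact one_pos)
    (by rw [innerNormal_im]; simp [innerNormal, Prod.norm_def])
  have hlimp := hg.tendsto_inv_smul_peakFunction
  have hsqrt : Tendsto (fun t : ℝ => √t) (𝓝[>] 0) (𝓝 0) := by
    have := Real.continuous_sqrt.tendsto 0
    rw [Real.sqrt_zero] at this
    exact this.mono_left nhdsWithin_le_nhds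
  have htid : Tendsto (fun t : ℝ => t) (𝓝[>] 0) (𝓝 0) := tendsto_id.mono_left nhdsWithin_le_nhds
  have hpeak0 : Tendsto (fun t : ℝ =>
      ‖peakFunction (φ' (F (φ.symm ((t : ℂ) • innerNormal n))))‖) (𝓝[>] 0) (𝓝 0) := by
    have h1 := htid.mul hlimp.norm
    rw [zero_mul] at h1
    refine h1.congr' ?_
    filter_upwards [self_mem_nhdsWithin] with t ht
    have ht : 0 < t := ht
    rw [norm_mul, norm_inv, Complex.norm_real, Real.norm_eq_abs, abs_of_pos ht]
    field_simp
  have hleft : Tendsto (fun t : ℝ => k ^ 5 * ‖(deriv (fun τ : ℂ => φ' (F (φ.symm (τ • (v, 0) +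
      (t : ℂ) • innerNormal n)))) 0).1‖ ^ 2) (𝓝[>] 0) (𝓝 (k ^ 5 * ‖(M (v, 0)).1‖ ^ 2)) :=
    (((continuous_fst.tendsto _).comp (hg.tendsto_deriv hv)).norm.pow 2).const_mul _
  have hright := (Complex.continuous_im.tendsto _).comp hlimp
  refine le_of_tendsto_of_tendsto hleft hright ?_
  obtain ⟨δ₁, hδ₁, hb⟩ := eventually_normalCone_iff.1 (hg.differentiableAt 1 one_pos)
  filter_upwards [Ioo_mem_nhdsGT (lt_min one_pos hδ₁),
    hsqrt.eventually (gt_mem_nhds (lt_min hδ (show 0 < (1 - k ^ 2) / K by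
      have : 0 < 1 - k ^ 2 := by nlinarith
      positivity))),
    hpeak0.eventually (gt_mem_nhds (show 0 < (1 - k) / 2 / K' by
      have : 0 < 1 - k := by linarith
      positivity)),
    ((hg.tendsto 1 one_pos).comp hcone).eventually hO₀] with t ht hts htp htO
  obtain ⟨ht0, ht1⟩ := ht
  rw [lt_min_iff] at ht1 hts
  set s := √t with hs
  have hs0 : 0 < s := Real.sqrt_pos.2 ht0
  have hst : s ^ 2 = t := Real.sq_sqrt ht0.le
  have hs1 : s < 1 := by nlinarith [ht1.1]
  set κ : ℂ := ((s * k : ℝ) : ℂ) with hκ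
  have hκn : ‖κ‖ = s * k := by
    rw [hκ, Complex.norm_real, Real.norm_eq_abs, abs_of_pos (by positivity)]
  set γ : ℂ → CoordSpace n := fun ζ => (ζ * κ) • (v, 0) + (t : ℂ) • innerNormal n with hγ
  obtain ⟨hfd, hfD⟩ := hdisc γ (by rw [hγ]; fun_prop) (by
    intro ζ hζ
    have hb2 := norm_parabolicDisc_le (v := v) hs0.le hs1.le hk0.le hk1.le hv
      (mem_ball_zero_iff.1 hζ).le
    rw [hst] at hb2
    refine ⟨hb2.1.trans_lt hts.1, ?_⟩
    have h5 : s * K < 1 - k ^ 2 := by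
      have := hts.2
      rwa [lt_div_iff₀ hK] at this
    refine (add_le_add (pow_le_pow_left₀ (norm_nonneg _) hb2.2.1 2)
      (mul_le_mul_of_nonneg_left (pow_le_pow_left₀ (norm_nonneg _) hb2.1 3) hK.le)).trans_lt ?_
    rw [hb2.2.2, ← hst]
    calc (s * k) ^ 2 + K * s ^ 3 = s ^ 2 * (k ^ 2 + s * K) := by ring
      _ < s ^ 2 * 1 := by gcongr; linarith
      _ = s ^ 2 := mul_one _)
  have hγ0 : γ 0 = (t : ℂ) • innerNormal n := by simp [hγ]
  -- The peak function at the centre tends to 0, so the excluded collar is eventually narrower than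
  -- (1 - k)/2.
  have hin : ∀ ζ ∈ Metric.ball (0 : ℂ) ((1 + k) / 2), _ := fun ζ hζ =>
    hloc _ hfd hfD (by rw [hγ0]; exact htO) ζ (by
      rw [lt_div_iff₀ hK'] at htp
      rw [hγ0]
      have := mem_ball_zero_iff.1 hζ
      linarith)
  have hsub : Metric.ball (0 : ℂ) ((1 + k) / 2) ⊆ Metric.ball 0 1 :=
    Metric.ball_subset_ball (by linarith)
  have hG : DifferentiableOn ℂ (fun ζ => φ' (F (φ.symm (γ ζ)))) (Metric.ball 0 ((1 + k) / 2)) :=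
    fun ζ hζ => (DifferentiableAt.comp (g := φ') ζ
      (hφ'.holomorphic.differentiableAt (φ'.open_source.mem_nhds (hin ζ hζ).2))
      (hfd.differentiableAt (Metric.isOpen_ball.mem_nhds (hsub hζ)))).differentiableWithinAt
  -- The weight a = k and the radius R = k contribute k·k², and the slope sk contributes k²: hence
  -- k⁵.
  have key := sq_norm_deriv_le_im (Z := fun ζ => (φ' (F (φ.symm (γ ζ)))).1)
    (W := fun ζ => peakFunction (φ' (F (φ.symm (γ ζ))))) hk0 hk0
    (show k < (1 + k) / 2 by linarith) hG.fst
    (differentiable_peakFunction.comp_differentiableOn hG)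
    (fun ζ hζ => ((hin ζ hζ).1 (hfD (hsub hζ))).1)
  set g : ℂ → CoordSpace n := fun τ => φ' (F (φ.symm (τ • (v, 0) + (t : ℂ) • innerNormal n)))
    with hgdef
  have hgd : DifferentiableAt ℂ g 0 := by
    refine DifferentiableAt.comp (g := fun ζ => φ' (F (φ.symm ζ))) 0 ?_ (by fun_prop)
    simp only [zero_smul, zero_add]
    have hn : ‖(t : ℂ) • innerNormal n‖ = t := by
      rw [norm_smul, Complex.norm_real, Real.norm_eq_abs, abs_of_pos ht0]
      simp [innerNormal, Prod.norm_def]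
    have hi : ((t : ℂ) • innerNormal n).2.im = t := by simp [innerNormal]
    exact hb _ (by rw [hn]; exact ht1.2) (by rw [hi]; exact ht0) (by rw [hn, hi, one_mul])
  have hder : deriv (fun ζ => (φ' (F (φ.symm (γ ζ)))).1) 0 = κ • (deriv g 0).1 := by
    simp only [hγ]
    exact deriv_fst_comp_mul hgd κ
  rw [hder, norm_smul, hκn, hγ0] at key
  simp only [Function.comp, Complex.mul_im, Complex.inv_re, Complex.inv_im, Complex.ofReal_re,
    Complex.ofReal_im, Complex.normSq_ofReal, neg_zero, zero_div, zero_mul, add_zero]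
  have h6 : t / (t * t) = t⁻¹ := by field_simp
  rw [h6, inv_mul_eq_div, le_div_iff₀ ht0]
  calc k ^ 5 * ‖(deriv g 0).1‖ ^ 2 * t = k * k ^ 2 * (s * k * ‖(deriv g 0).1‖) ^ 2 := by
        rw [← hst]; ring
    _ ≤ _ := key

end CoordGerm

/-! ### The model map realizing a given differential -/

/-- The angle 5|θ|/4 lies in [9π/16, 5π/4], inside (π/2, 3π/2). Here θ = arg(-iw), so the 5/4 power
gains height in all directions at angle at least 9π/20 from the inner normal. -/
theorem exists_cos_le_neg : ∃ c > 0, ∀ θ : ℝ, 9 * Real.pi / 20 ≤ |θ| → |θ| ≤ Real.pi →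
    Real.cos (θ * (5 / 4)) ≤ -c := by
  obtain ⟨x, hx, hmax⟩ := (isCompact_Icc (a := 9 * Real.pi / 16) (b := 5 * Real.pi / 4)).exists_isMaxOn
    ⟨9 * Real.pi / 16, by constructor <;> linarith [Real.pi_pos]⟩ Real.continuous_cos.continuousOn
  have hneg : Real.cos x < 0 := Real.cos_neg_of_pi_div_two_lt_of_lt
    (by linarith [hx.1, Real.pi_pos]) (by linarith [hx.2, Real.pi_pos])
  refine ⟨-Real.cos x, by linarith, fun θ h1 h2 => ?_⟩
  rw [neg_neg, ← Real.cos_abs, abs_mul, abs_of_pos (show (0 : ℝ) < 5 / 4 by norm_num)]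
  exact hmax ⟨by linarith, by linarith⟩

theorem half_le_cos_div_eight {θ : ℝ} (h : |θ| ≤ Real.pi) : 1 / 2 ≤ Real.cos (θ * (1 / 8)) := by
  rw [← Real.cos_pi_div_three, ← Real.cos_abs (θ * (1 / 8)), abs_mul,
    abs_of_pos (show (0 : ℝ) < 1 / 8 by norm_num)]
  apply Real.cos_le_cos_of_nonneg_of_le_pi (by positivity) <;> linarith [Real.pi_pos]

theorem exp_neg_le_one_sub_half {u : ℝ} (h0 : 0 ≤ u) (h1 : u ≤ 1) : Real.exp (-u) ≤ 1 - u / 2 := by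
  rw [Real.exp_neg]
  have h2 := Real.add_one_le_exp u
  rw [inv_le_iff_one_le_mul₀ (Real.exp_pos u)]
  nlinarith

/-- The weight `exp (-(-i w)^(1/8))`, of modulus less than one on the upper half-plane. -/
noncomputable def shrinkFactor (w : ℂ) : ℂ :=
  Complex.exp (-((-Complex.I * w) ^ (((1 / 8 : ℝ)) : ℂ)))

/-- The correction `(-i w)^(5/4)`. -/
noncomputable def liftTerm (w : ℂ) : ℂ := (-Complex.I * w) ^ (((5 / 4 : ℝ)) : ℂ)

theorem norm_neg_I_mul (w : ℂ) : ‖-Complex.I * w‖ = ‖w‖ := by simp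

theorem norm_shrinkFactor_le_one (w : ℂ) : ‖shrinkFactor w‖ ≤ 1 := by
  rw [shrinkFactor, Complex.norm_exp, Real.exp_le_one_iff, Complex.neg_re, Complex.cpow_ofReal_re]
  have := half_le_cos_div_eight (Complex.abs_arg_le_pi (-Complex.I * w))
  have : 0 ≤ Real.cos ((-Complex.I * w).arg * (1 / 8)) := by linarith
  have : 0 ≤ ‖-Complex.I * w‖ ^ (1 / 8 : ℝ) := by positivity
  rw [neg_nonpos]
  positivity

theorem sq_norm_shrinkFactor_le {w : ℂ} {u : ℝ} (hu0 : 0 ≤ u) (hu1 : u ≤ 1) (hw : u ^ 8 = ‖w‖) :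
    ‖shrinkFactor w‖ ^ 2 ≤ 1 - u / 2 := by
  refine le_trans ?_ (exp_neg_le_one_sub_half hu0 hu1)
  rw [shrinkFactor, Complex.norm_exp, ← Real.exp_nat_mul, Complex.neg_re, Complex.cpow_ofReal_re,
    norm_neg_I_mul, ← hw]
  have h1 : (u ^ 8) ^ (1 / 8 : ℝ) = u := by
    rw [← Real.rpow_natCast u 8, ← Real.rpow_mul hu0]; norm_num
  rw [h1]
  apply Real.exp_le_exp.2
  have := mul_le_mul_of_nonneg_left
    (half_le_cos_div_eight (Complex.abs_arg_le_pi (-Complex.I * w))) hu0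
  push_cast
  linarith

theorem re_liftTerm {w : ℂ} {u : ℝ} (hu0 : 0 ≤ u) (hw : u ^ 8 = ‖w‖) :
    (liftTerm w).re = u ^ 10 * Real.cos ((-Complex.I * w).arg * (5 / 4)) := by
  rw [liftTerm, Complex.cpow_ofReal_re, norm_neg_I_mul, ← hw, ← Real.rpow_natCast u 8,
    ← Real.rpow_mul hu0, ← Real.rpow_natCast u 10]
  norm_num

theorem norm_liftTerm {w : ℂ} {u : ℝ} (hu0 : 0 ≤ u) (hw : u ^ 8 = ‖w‖) :
    ‖liftTerm w‖ = u ^ 10 := by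
  rw [liftTerm, Complex.norm_cpow_real, norm_neg_I_mul, ← hw, ← Real.rpow_natCast u 8,
    ← Real.rpow_mul hu0, ← Real.rpow_natCast u 10]
  norm_num

theorem tendsto_shrinkFactor : Tendsto shrinkFactor (𝓝 0) (𝓝 1) := by
  have h1 : Tendsto (fun w : ℂ => (-Complex.I * w) ^ (((1 / 8 : ℝ)) : ℂ)) (𝓝 0) (𝓝 0) := by
    rw [tendsto_zero_iff_norm_tendsto_zero]
    simp_rw [Complex.norm_cpow_real, norm_neg_I_mul]
    have h2 : Continuous fun w : ℂ => ‖w‖ ^ (1 / 8 : ℝ) :=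
      continuous_norm.rpow_const fun _ => Or.inr (by norm_num)
    have h3 := h2.tendsto 0
    rwa [norm_zero, Real.zero_rpow (by norm_num)] at h3
  have h4 := (Complex.continuous_exp.tendsto _).comp h1.neg
  rwa [neg_zero, Complex.exp_zero] at h4

theorem liftTerm_isLittleO : liftTerm =o[𝓝 0] fun w : ℂ => w := by
  have h2 : Continuous fun w : ℂ => ‖w‖ ^ (1 / 4 : ℝ) :=
    continuous_norm.rpow_const fun _ => Or.inr (by norm_num)
  have h3 := h2.tendsto 0
  rw [norm_zero, Real.zero_rpow (by norm_num)] at h3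
  rw [Asymptotics.isLittleO_iff]
  intro ε hε
  filter_upwards [h3.eventually (gt_mem_nhds hε)] with w hw
  rw [liftTerm, Complex.norm_cpow_real, norm_neg_I_mul,
    show (5 / 4 : ℝ) = 1 / 4 + 1 by norm_num, Real.rpow_add_one' (norm_nonneg _) (by norm_num)]
  gcongr

theorem differentiableAt_shrinkFactor {w : ℂ} (h : -Complex.I * w ∈ Complex.slitPlane) :
    DifferentiableAt ℂ shrinkFactor w := by
  unfold shrinkFactor
  fun_prop (disch := assumption)

theorem differentiableAt_liftTerm {w : ℂ} (h : -Complex.I * w ∈ Complex.slitPlane) :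
    DifferentiableAt ℂ liftTerm w := by
  unfold liftTerm
  fun_prop (disch := assumption)

/-- A holomorphic map between domains in normal form with prescribed differential at the origin. -/
noncomputable def modelMap {n : ℕ} (T : EuclideanSpace ℂ (Fin n) →L[ℂ] EuclideanSpace ℂ (Fin n))
    (A : EuclideanSpace ℂ (Fin n)) (lam : ℝ) (ζ : CoordSpace n) : CoordSpace n :=
  (shrinkFactor ζ.2 • T ζ.1 + ζ.2 • A, lam * ζ.2 - Complex.I * liftTerm ζ.2)

/-- The linear map `(z, w) ↦ (T z + w A, lam w)`. -/
noncomputable def blockMap {n : ℕ} (T : EuclideanSpace ℂ (Fin n) →L[ℂ] EuclideanSpace ℂ (Fin n))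
    (A : EuclideanSpace ℂ (Fin n)) (lam : ℝ) : CoordSpace n →L[ℂ] CoordSpace n :=
  (T.comp (ContinuousLinearMap.fst ℂ _ _) +
      (ContinuousLinearMap.snd ℂ _ _).smulRight A).prod
    ((lam : ℂ) • ContinuousLinearMap.snd ℂ _ _)

section model

variable {n : ℕ} (T : EuclideanSpace ℂ (Fin n) →L[ℂ] EuclideanSpace ℂ (Fin n))
  (A : EuclideanSpace ℂ (Fin n)) (lam : ℝ)

theorem blockMap_apply (ζ : CoordSpace n) :
    blockMap T A lam ζ = (T ζ.1 + ζ.2 • A, (lam : ℂ) * ζ.2) := rfl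

theorem modelMap_zero : modelMap T A lam 0 = 0 := by
  simp [modelMap, liftTerm, Complex.zero_cpow]

theorem differentiableAt_modelMap {ζ : CoordSpace n} (h : -Complex.I * ζ.2 ∈ Complex.slitPlane) :
    DifferentiableAt ℂ (modelMap T A lam) ζ := by
  have h1 : DifferentiableAt ℂ (fun ζ : CoordSpace n => shrinkFactor ζ.2) ζ :=
    DifferentiableAt.comp (g := shrinkFactor) ζ (differentiableAt_shrinkFactor h) differentiableAt_snd
  have h2 : DifferentiableAt ℂ (fun ζ : CoordSpace n => liftTerm ζ.2) ζ :=
    DifferentiableAt.comp (g := liftTerm) ζ (differentiableAt_liftTerm h) differentiableAt_snd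
  unfold modelMap
  fun_prop

/-- The shrinking factor tends to 1 and the correction is o(w) in every direction, across the branch
cut too. Hence the derivative at 0 exists in the full real sense. -/
theorem hasFDerivAt_modelMap :
    HasFDerivAt (𝕜 := ℝ) (modelMap T A lam) ((blockMap T A lam).restrictScalars ℝ) 0 := by
  have hO : (fun ζ : CoordSpace n => ζ.2) =O[𝓝 0] fun ζ => ζ :=
    Asymptotics.isBigO_of_le _ norm_snd_le
  have hsnd : Tendsto (fun ζ : CoordSpace n => ζ.2) (𝓝 0) (𝓝 0) := continuous_snd.tendsto 0
  have h1 : (fun ζ : CoordSpace n => (shrinkFactor ζ.2 - 1) • T ζ.1) =o[𝓝 0] fun ζ => ζ := by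
    have h2 : (fun ζ : CoordSpace n => shrinkFactor ζ.2 - 1) =o[𝓝 0] fun _ => (1 : ℝ) := by
      rw [Asymptotics.isLittleO_one_iff]
      have := (tendsto_shrinkFactor.comp hsnd).sub_const 1
      rwa [sub_self] at this
    have h3 : (fun ζ : CoordSpace n => T ζ.1) =O[𝓝 0] fun ζ => ζ :=
      (T.comp (ContinuousLinearMap.fst ℂ (EuclideanSpace ℂ (Fin n)) ℂ)).isBigO_id (𝓝 0)
    simpa using h2.smul_isBigO h3
  have h4 : (fun ζ : CoordSpace n => -(Complex.I * liftTerm ζ.2)) =o[𝓝 0] fun ζ => ζ :=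
    (((liftTerm_isLittleO.comp_tendsto hsnd).trans_isBigO hO).const_mul_left _).neg_left
  refine HasFDerivAt.of_isLittleO ((h1.prod_left h4).congr (fun ζ => ?_) fun ζ => ?_)
  · rw [modelMap_zero, sub_zero, sub_zero]
    change _ = modelMap T A lam ζ - blockMap T A lam ζ
    rw [blockMap_apply, modelMap, Prod.mk_sub_mk]
    refine Prod.ext ?_ ?_
    · simp only [sub_smul, one_smul]; abel
    · simp only; ring
  · rw [sub_zero]

end model

/-- Here N = ‖z‖², y = Im w, u = |w|^(1/8), q is the squared shrinking factor and X the cosine in Re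
(-iw)^(5/4). If X ≤ -c₁, the gain c₁u¹⁰ beats the errors u¹²; if y ≥ c₂u⁸, shrinking gains a
multiple of u⁹, which beats both u¹⁰ and u¹². -/
theorem scalar_gain {lam K₁ K₂ c₁ c₂ u y N q X : ℝ} (hlam : 0 < lam) (hK₁ : 0 ≤ K₁) (hK₂ : 0 ≤ K₂)
    (hu0 : 0 < u) (hu1 : u ≤ 1) (hN : 0 ≤ N) (hNy : N < y + K₁ * u ^ 12)
    (hq1 : q ≤ 1 - u / 2) (hX : |X| ≤ 1) (hu2 : u * (K₂ + lam * K₁) < c₁)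
    (hu3 : u * (1 + K₂ + lam * K₁) < lam * c₂ / 2) (h : X ≤ -c₁ ∨ c₂ * u ^ 8 ≤ y) :
    q * lam * N + K₂ * u ^ 12 < lam * y - u ^ 10 * X := by
  have hB : 0 ≤ K₂ + lam * K₁ := by positivity
  have hqN : q * lam * N ≤ (1 - u / 2) * lam * N := by gcongr
  rcases h with h | h
  · have h1 : (1 - u / 2) * lam * N ≤ lam * N := by
      have : 0 ≤ u / 2 * (lam * N) := by positivity
      linarith
    have h2 : lam * N ≤ lam * (y + K₁ * u ^ 12) := by gcongr
    have h3 : u ^ 10 * c₁ ≤ -(u ^ 10 * X) := by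
      have := mul_le_mul_of_nonneg_left h (by positivity : 0 ≤ u ^ 10)
      linarith
    have h4 : u ^ 10 * (u * (K₂ + lam * K₁)) < u ^ 10 * c₁ := by gcongr
    have h5 : u ^ 12 * (K₂ + lam * K₁) ≤ u ^ 11 * (K₂ + lam * K₁) := by
      gcongr ?_ * _
      exact pow_le_pow_of_le_one hu0.le hu1 (by norm_num)
    linarith
  · have h1 : (1 - u / 2) * lam * N ≤ (1 - u / 2) * lam * (y + K₁ * u ^ 12) := by
      have : 0 ≤ 1 - u / 2 := by linarith
      gcongr
    have h2 : lam * (u / 2) * (c₂ * u ^ 8) ≤ lam * (u / 2) * y := by gcongr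
    have h3 : u ^ 10 * X ≤ u ^ 10 := mul_le_of_le_one_right (by positivity) (le_of_abs_le hX)
    have h4 : u ^ 9 * (u * (1 + K₂ + lam * K₁)) < u ^ 9 * (lam * c₂ / 2) := by gcongr
    have h5 : u ^ 12 * (K₂ + lam * K₁) ≤ u ^ 10 * (K₂ + lam * K₁) := by
      gcongr ?_ * _
      exact pow_le_pow_of_le_one hu0.le hu1 (by norm_num)
    have h6 : 0 ≤ u / 2 * lam * (K₁ * u ^ 12) := by positivity
    linarith

/-- On D the squared norm of z is O(|w|), so ‖ζ‖ = O(u⁴) and cubic terms are O(u¹²). -/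
theorem scalar_size {M N s u y : ℝ} (hM : 0 ≤ M) (hu0 : 0 ≤ u) (hu1 : u ≤ 1) (hs0 : 0 ≤ s)
    (hs : M * s ≤ 1 / 4) (hsN : s ^ 2 ≤ N + (u ^ 8) ^ 2) (hy : y ≤ u ^ 8)
    (h : N - M * s ^ 3 < y) : N ≤ 2 * u ^ 8 ∧ s ≤ 2 * u ^ 4 ∧ N < y + 8 * M * u ^ 12 := by
  have h1 : (u ^ 8) ^ 2 ≤ u ^ 8 := by
    have : u ^ 8 ≤ 1 := pow_le_one₀ hu0 hu1
    nlinarith [pow_nonneg hu0 8]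
  have h2 : M * s ^ 3 ≤ 1 / 4 * s ^ 2 := by
    have : M * s * s ^ 2 ≤ 1 / 4 * s ^ 2 := by gcongr
    linarith [show M * s ^ 3 = M * s * s ^ 2 by ring]
  have h3 : N ≤ 2 * u ^ 8 := by nlinarith [pow_nonneg hu0 8]
  have h4 : s ≤ 2 * u ^ 4 := by
    rw [← sq_le_sq₀ hs0 (by positivity)]
    nlinarith [pow_nonneg hu0 8]
  have h5 : s ^ 3 ≤ (2 * u ^ 4) ^ 3 := by gcongr
  have h6 : M * s ^ 3 ≤ M * (2 * u ^ 4) ^ 3 := by gcongr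
  refine ⟨h3, h4, ?_⟩
  linarith [show M * (2 * u ^ 4) ^ 3 = 8 * M * u ^ 12 by ring]

/-- All quantities are measured in u = |w|^(1/8). The cross term of Tz and wA is of order u⁴·u⁸, the
same as the cubic remainders, and `scalar_gain` absorbs both. -/
theorem modelMap_mem {n : ℕ} {T : EuclideanSpace ℂ (Fin n) →L[ℂ] EuclideanSpace ℂ (Fin n)}
    (A : EuclideanSpace ℂ (Fin n)) {lam : ℝ} (hlam : 0 < lam) (hT : ∀ z, ‖T z‖ ≤ √lam * ‖z‖)
    {M M' : ℝ} (hM : 0 ≤ M) (hM' : 0 ≤ M') :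
    ∀ᶠ ζ in 𝓝 (0 : CoordSpace n), ‖ζ.1‖ ^ 2 - M * ‖ζ‖ ^ 3 < ζ.2.im →
      -Complex.I * ζ.2 ∈ Complex.slitPlane ∧
      ‖(modelMap T A lam ζ).1‖ ^ 2 + M' * ‖modelMap T A lam ζ‖ ^ 3 < (modelMap T A lam ζ).2.im := by
  obtain ⟨c₁, hc₁, hcos⟩ := exists_cos_le_neg
  set c₂ : ℝ := Real.cos (9 * Real.pi / 20) with hc₂def
  have hc₂ : 0 < c₂ := Real.cos_pos_of_mem_Ioo ⟨by linarith [Real.pi_pos], by linarith [Real.pi_pos]⟩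
  set B : ℝ := 2 * √lam + ‖A‖ + lam + 1 with hB
  have hB0 : 0 ≤ B := by positivity
  set K₁ : ℝ := 8 * M with hK₁
  set K₂ : ℝ := 4 * √lam * ‖A‖ + ‖A‖ ^ 2 + M' * B ^ 3 with hK₂
  have hK₂0 : 0 ≤ K₂ := by positivity
  have hK₁0 : 0 ≤ K₁ := by positivity
  have hs : Tendsto (fun ζ : CoordSpace n => M * ‖ζ‖) (𝓝 0) (𝓝 0) := by
    have : Continuous fun ζ : CoordSpace n => M * ‖ζ‖ := by fun_prop
    simpa using this.tendsto 0
  have hu : Tendsto (fun ζ : CoordSpace n => ‖ζ.2‖ ^ (1 / 8 : ℝ)) (𝓝 0) (𝓝 0) := by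
    have : Continuous fun ζ : CoordSpace n => ‖ζ.2‖ ^ (1 / 8 : ℝ) :=
      (continuous_norm.comp continuous_snd).rpow_const fun _ => Or.inr (by norm_num)
    simpa using this.tendsto 0
  have hev : ∀ (K c : ℝ), 0 < c → ∀ᶠ ζ in 𝓝 (0 : CoordSpace n), ‖ζ.2‖ ^ (1 / 8 : ℝ) * K < c := by
    intro K c hc
    have := hu.mul_const K
    rw [zero_mul] at this
    exact this.eventually (gt_mem_nhds hc)
  filter_upwards [hs.eventually (gt_mem_nhds (show (0 : ℝ) < 1 / 4 by norm_num)),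
    hu.eventually (gt_mem_nhds one_pos), hev (K₂ + lam * K₁) c₁ hc₁,
    hev (1 + K₂ + lam * K₁) (lam * c₂ / 2) (by positivity), hev K₁ 1 one_pos]
    with ζ h1 h2 h3 h4 h5 hζ
  set u : ℝ := ‖ζ.2‖ ^ (1 / 8 : ℝ) with hudef
  have hu0 : 0 ≤ u := by positivity
  have huw : u ^ 8 = ‖ζ.2‖ := by
    rw [hudef, ← Real.rpow_natCast, ← Real.rpow_mul (norm_nonneg _)]; norm_num
  have hsq : ‖ζ‖ ^ 2 ≤ ‖ζ.1‖ ^ 2 + (u ^ 8) ^ 2 := by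
    rw [huw, Prod.norm_def]
    rcases max_choice ‖ζ.1‖ ‖ζ.2‖ with h6 | h6 <;> rw [h6]
    · nlinarith [sq_nonneg ‖ζ.2‖]
    · nlinarith [sq_nonneg ‖ζ.1‖]
  have hyw : |ζ.2.im| ≤ u ^ 8 := by rw [huw]; exact Complex.abs_im_le_norm _
  obtain ⟨hN2, hs2, hNy⟩ := scalar_size hM hu0 h2.le (norm_nonneg ζ) h1.le hsq
    ((le_abs_self _).trans hyw) hζ
  have hz2 : ‖ζ.1‖ ≤ 2 * u ^ 4 := (norm_fst_le ζ).trans hs2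
  have hupos : 0 < u := by
    refine hu0.lt_of_ne fun h6 => ?_
    rw [← h6] at hNy hyw
    norm_num at hNy hyw
    rw [hyw] at hNy
    nlinarith [sq_nonneg ‖ζ.1‖]
  have hu12 : u ^ 12 * K₁ < u ^ 8 := by
    have e1 : u ^ 12 * K₁ ≤ u ^ 9 * K₁ := by
      gcongr ?_ * _
      exact pow_le_pow_of_le_one hu0 h2.le (by norm_num)
    have e2 : u ^ 8 * (u * K₁) < u ^ 8 * 1 := by gcongr
    linarith
  have hre : (-Complex.I * ζ.2).re = ζ.2.im := by simp
  have him : (-Complex.I * ζ.2).im = -ζ.2.re := by simp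
  -- On the cut Im w = -|w| = -u⁸, but Im w > -8Mu¹² > -u⁸ on D.
  have hslit : -Complex.I * ζ.2 ∈ Complex.slitPlane := by
    rw [Complex.mem_slitPlane_iff, hre, him]
    by_contra! hcon
    have hx : ζ.2.re = 0 := by linarith [hcon.2]
    have hy : ‖ζ.2‖ = -ζ.2.im := by
      have : ζ.2 = (ζ.2.im : ℂ) * Complex.I := by
        apply Complex.ext <;> simp [hx]
      rw [this, norm_mul, Complex.norm_I, Complex.norm_real, Real.norm_eq_abs, abs_of_nonpos hcon.1]
      simp
    rw [← huw] at hy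
    linarith [sq_nonneg ‖ζ.1‖, show u ^ 12 * K₁ = 8 * M * u ^ 12 by rw [hK₁]; ring]
  refine ⟨hslit, ?_⟩
  have harg := Complex.abs_arg_le_pi (-Complex.I * ζ.2)
  set θ := (-Complex.I * ζ.2).arg with hθ
  -- Either w is far from the inner normal direction and the 5/4 power helps, or Im w = |w| cos θ is
  -- comparable to |w|.
  have hcase : Real.cos (θ * (5 / 4)) ≤ -c₁ ∨ c₂ * u ^ 8 ≤ ζ.2.im := by
    rcases le_or_gt (9 * Real.pi / 20) |θ| with h6 | h6
    · exact Or.inl (hcos θ h6 harg)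
    · right
      have h7 := Complex.norm_mul_cos_arg (-Complex.I * ζ.2)
      rw [norm_neg_I_mul, hre, ← huw, ← hθ, ← Real.cos_abs] at h7
      rw [← h7, mul_comm]
      gcongr
      exact Real.cos_le_cos_of_nonneg_of_le_pi (abs_nonneg _) (by linarith [Real.pi_pos]) h6.le
  have hq := sq_norm_shrinkFactor_le hu0 h2.le huw
  have hgain := scalar_gain hlam hK₁0 hK₂0 hupos h2.le (sq_nonneg ‖ζ.1‖) (by linarith) hq
    (Real.abs_cos_le_one (θ * (5 / 4))) h3 h4 hcase
  set q := ‖shrinkFactor ζ.2‖ with hqdef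
  have hq1 : q ≤ 1 := norm_shrinkFactor_le_one ζ.2
  have hq0 : 0 ≤ q := norm_nonneg _
  have hw' : (modelMap T A lam ζ).2.im = lam * ζ.2.im - u ^ 10 * Real.cos (θ * (5 / 4)) := by
    rw [hθ, ← re_liftTerm hu0 huw]
    simp [modelMap]
  have hz' : ‖(modelMap T A lam ζ).1‖ ≤ q * (√lam * ‖ζ.1‖) + u ^ 8 * ‖A‖ := by
    refine (norm_add_le _ _).trans ?_
    rw [norm_smul, norm_smul, huw]
    gcongr
    exact hT _
  have hu84 : u ^ 8 ≤ u ^ 4 := pow_le_pow_of_le_one hu0 h2.le (by norm_num)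
  have hu104 : u ^ 10 ≤ u ^ 4 := pow_le_pow_of_le_one hu0 h2.le (by norm_num)
  have hnorm : ‖modelMap T A lam ζ‖ ≤ B * u ^ 4 := by
    rw [Prod.norm_def]
    refine max_le (hz'.trans ?_) ?_
    · calc q * (√lam * ‖ζ.1‖) + u ^ 8 * ‖A‖ ≤ 1 * (√lam * (2 * u ^ 4)) + u ^ 4 * ‖A‖ := by gcongr
        _ ≤ B * u ^ 4 := by
          rw [hB]
          have : 0 ≤ (lam + 1) * u ^ 4 := by positivity
          linarith
    · have e1 : ‖(modelMap T A lam ζ).2‖ ≤ lam * u ^ 8 + u ^ 10 := by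
        refine (norm_sub_le _ _).trans ?_
        rw [norm_mul, norm_mul, Complex.norm_I, one_mul, norm_liftTerm hu0 huw, Complex.norm_real,
          Real.norm_eq_abs, abs_of_pos hlam, huw]
      refine e1.trans ?_
      calc lam * u ^ 8 + u ^ 10 ≤ lam * u ^ 4 + u ^ 4 := by gcongr
        _ ≤ B * u ^ 4 := by
          rw [hB]
          have : 0 ≤ (2 * √lam + ‖A‖) * u ^ 4 := by positivity
          linarith
  have hfin1 : ‖(modelMap T A lam ζ).1‖ ^ 2 ≤
      q ^ 2 * lam * ‖ζ.1‖ ^ 2 + (4 * √lam * ‖A‖ + ‖A‖ ^ 2) * u ^ 12 := by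
    have e1 : ‖(modelMap T A lam ζ).1‖ ^ 2 ≤ (q * (√lam * ‖ζ.1‖) + u ^ 8 * ‖A‖) ^ 2 := by gcongr
    have e2 : q * (√lam * ‖ζ.1‖) * (u ^ 8 * ‖A‖) ≤ 1 * (√lam * (2 * u ^ 4)) * (u ^ 8 * ‖A‖) := by
      gcongr
    have e3 : (u ^ 8 * ‖A‖) ^ 2 ≤ ‖A‖ ^ 2 * u ^ 12 := by
      have : u ^ 16 ≤ u ^ 12 := pow_le_pow_of_le_one hu0 h2.le (by norm_num)
      calc (u ^ 8 * ‖A‖) ^ 2 = ‖A‖ ^ 2 * u ^ 16 := by ring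
        _ ≤ _ := by gcongr
    have e4 : √lam ^ 2 = lam := Real.sq_sqrt hlam.le
    calc _ ≤ _ := e1
      _ = q ^ 2 * √lam ^ 2 * ‖ζ.1‖ ^ 2 + 2 * (q * (√lam * ‖ζ.1‖) * (u ^ 8 * ‖A‖)) +
          (u ^ 8 * ‖A‖) ^ 2 := by ring
      _ ≤ q ^ 2 * √lam ^ 2 * ‖ζ.1‖ ^ 2 + 2 * (1 * (√lam * (2 * u ^ 4)) * (u ^ 8 * ‖A‖)) +
          ‖A‖ ^ 2 * u ^ 12 := by gcongr
      _ = _ := by rw [e4]; ring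
  have hfin2 : M' * ‖modelMap T A lam ζ‖ ^ 3 ≤ M' * B ^ 3 * u ^ 12 := by
    calc _ ≤ M' * (B * u ^ 4) ^ 3 := by gcongr
      _ = _ := by ring
  rw [hw']
  refine lt_of_le_of_lt (add_le_add hfin1 hfin2) ?_
  rw [hK₂] at hgain
  linarith

/-! ### Singular values -/

section singular

variable {E : Type*} [NormedAddCommGroup E] [InnerProductSpace ℂ E] [FiniteDimensional ℂ E]

open Polynomial in
/-- The sorted eigenvalues of a symmetric operator are read off any orthonormal eigenbasis whose
eigenvalues are in decreasing order. -/
theorem LinearMap.IsSymmetric.eigenvalues_eq_of_apply_basis {S : E →ₗ[ℂ] E} (hS : S.IsSymmetric)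
    {m : ℕ} (hm : Module.finrank ℂ E = m) (b : OrthonormalBasis (Fin m) ℂ E) {μ : Fin m → ℝ}
    (hμ : Antitone μ) (hb : ∀ i, S (b i) = (μ i : ℂ) • b i) : hS.eigenvalues hm = μ := by
  have hmat : S.toMatrix b.toBasis b.toBasis = Matrix.diagonal (fun i => (μ i : ℂ)) := by
    ext i j
    rw [LinearMap.toMatrix_apply, OrthonormalBasis.coe_toBasis, hb, map_smul, Finsupp.smul_apply,
      Matrix.diagonal_apply, OrthonormalBasis.coe_toBasis_repr_apply, b.repr_self]
    by_cases h : i = j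
    · subst h; simp
    · simp [h]
  have hroots : S.charpoly.roots = Multiset.map (fun i => (μ i : ℂ)) Finset.univ.val := by
    rw [← S.charpoly_toMatrix b.toBasis, hmat, Matrix.charpoly_diagonal,
      Polynomial.roots_prod _ _ (by
        simp [Finset.prod_ne_zero_iff, Polynomial.X_sub_C_ne_zero])]
    simp
  -- Both families are the sorted list of roots of the characteristic polynomial; μ is already in
  -- decreasing order.
  rw [← List.ofFn_inj, ← hS.sort_roots_charpoly_eq_eigenvalues hm, hroots]
  simp only [Fin.univ_val_map, Multiset.map_coe, List.map_ofFn, Function.comp_def,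
    Multiset.coe_sort]
  convert! List.mergeSort_of_pairwise ?_
  simp_rw [decide_eq_true_eq, ← List.sortedGE_iff_pairwise]
  convert! hμ.sortedGE_ofFn

/-- If T₂ = cVT₁U then T₂*T₂ = c²U⁻¹(T₁*T₁)U, so U⁻¹ carries an eigenbasis of T₁*T₁ to one of T₂*T₂,
with eigenvalues multiplied by c². -/
theorem LinearMap.singularValues_smul_conj (T₁ T₂ : E →ₗ[ℂ] E) (U V : E ≃ₗᵢ[ℂ] E) {c : ℝ}
    (hc : 0 ≤ c) (h : ∀ x, T₂ x = (c : ℂ) • V (T₁ (U x))) (i : ℕ) :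
    T₂.singularValues i = c * T₁.singularValues i := by
  rcases le_or_gt (Module.finrank ℂ E) i with hi | hi
  · rw [singularValues_of_finrank_le _ hi, singularValues_of_finrank_le _ hi, mul_zero]
  have hb₁ := T₁.isSymmetric_adjoint_comp_self.apply_eigenvectorBasis rfl
  set b := T₁.isSymmetric_adjoint_comp_self.eigenvectorBasis rfl with hbdef
  set μ := T₁.isSymmetric_adjoint_comp_self.eigenvalues rfl with hμ
  have hadj : ∀ x, (adjoint T₂ ∘ₗ T₂) (U.symm x) =
      ((c ^ 2 : ℝ) : ℂ) • U.symm ((adjoint T₁ ∘ₗ T₁) x) := by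
    intro x
    refine ext_inner_left ℂ fun y => ?_
    have hU : ∀ z, inner ℂ y (U.symm z) = inner ℂ (U y) z := fun z => by
      rw [← U.inner_map_map y, U.apply_symm_apply]
    rw [comp_apply, adjoint_inner_right, inner_smul_right, hU, comp_apply, adjoint_inner_right,
      h, h, U.apply_symm_apply, inner_smul_left, inner_smul_right, V.inner_map_map,
      Complex.conj_ofReal, ← mul_assoc, ← Complex.ofReal_mul, pow_two]
  have heig := T₂.isSymmetric_adjoint_comp_self.eigenvalues_eq_of_apply_basis rfl (b.map U.symm)
    (μ := fun i => c ^ 2 * μ i)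
    ((T₁.isSymmetric_adjoint_comp_self.eigenvalues_antitone rfl).const_mul (sq_nonneg c))
    (fun i => by
      rw [OrthonormalBasis.map_apply, hadj, hb₁, map_smul, smul_smul, Complex.ofReal_mul]
      rfl)
  rw [T₂.singularValues_of_lt rfl hi, T₁.singularValues_of_lt rfl hi, heig]
  rw [Real.sqrt_mul (sq_nonneg c), Real.sqrt_sq hc]

/-- In an orthonormal eigenbasis of T*T, ‖Tx‖² is the sum of the squared singular values weighted by
the squared coordinates of x. -/
theorem LinearMap.forall_singularValues_le_iff (T : E →ₗ[ℂ] E) {m : ℕ}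
    (hm : Module.finrank ℂ E = m) {s : ℝ} (hs : 0 ≤ s) :
    (∀ j : Fin m, T.singularValues j ≤ s) ↔ ∀ x, ‖T x‖ ≤ s * ‖x‖ := by
  have hsym := T.isSymmetric_adjoint_comp_self
  have hb := hsym.apply_eigenvectorBasis hm
  have hnorm : ∀ x, ‖T x‖ ^ 2 = RCLike.re (inner ℂ x ((adjoint T ∘ₗ T) x)) := fun x => by
    rw [comp_apply, adjoint_inner_right, inner_self_eq_norm_sq]
  set b := hsym.eigenvectorBasis hm with hbdef
  constructor
  · intro h x
    rw [← sq_le_sq₀ (norm_nonneg _) (by positivity), hnorm, ← b.sum_inner_mul_inner, map_sum,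
      mul_pow, ← b.sum_sq_norm_inner_right x, Finset.mul_sum]
    refine Finset.sum_le_sum fun i _ => ?_
    rw [← hsym (b i) x, hb, inner_smul_left, RCLike.conj_ofReal]
    have h1 : inner ℂ x (b i) * (((hsym.eigenvalues hm i : ℝ) : ℂ) * inner ℂ (b i) x) =
        ((hsym.eigenvalues hm i * ‖inner ℂ (b i) x‖ ^ 2 : ℝ) : ℂ) := by
      rw [← inner_conj_symm x (b i)]
      have := Complex.conj_mul' (inner ℂ (b i) x)
      push_cast
      rw [← this]; ring
    refine (le_of_eq (congrArg RCLike.re h1)).trans ?_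
    rw [RCLike.re_eq_complex_re, Complex.ofReal_re, ← T.sq_singularValues_fin hm]
    gcongr
    · exact T.singularValues_nonneg _
    · exact h i
  · intro h j
    have h1 := h (b j)
    rw [b.norm_eq_one, mul_one] at h1
    refine le_trans (le_of_sq_le_sq ?_ (norm_nonneg _)) h1
    rw [hnorm, hb, inner_smul_right, inner_self_eq_norm_sq_to_K, b.norm_eq_one,
      T.sq_singularValues_fin hm]
    simp

end singular

theorem forall_matrixSingularValue_le_iff {n : ℕ} (C : Matrix (Fin n) (Fin n) ℂ) {s : ℝ}
    (hs : 0 ≤ s) :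
    (∀ j, matrixSingularValue C j ≤ s) ↔ ∀ z, ‖Matrix.toEuclideanLin C z‖ ≤ s * ‖z‖ :=
  (Matrix.toEuclideanLin C).forall_singularValues_le_iff (by simp) hs

/-! ### Characterization of the differentials and invariance of the ratios -/

section main

variable {n : ℕ} {D D' : Set (AmbientSpace n)} {p p' : AmbientSpace n}
  {φ φ' : OpenPartialHomeomorph (AmbientSpace n) (CoordSpace n)}
  {L : AmbientSpace n →ₗ[ℝ] AmbientSpace n} {C : Matrix (Fin n) (Fin n) ℂ}
  {A : EuclideanSpace ℂ (Fin n)} {lam : ℝ}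

theorem IsGermDifferential.of_hasFDerivAt {F : AmbientSpace n → AmbientSpace n}
    {U : Set (AmbientSpace n)} (hU : IsOpen U) (hpU : p ∈ U) (hFd : DifferentiableOn ℂ F (U ∩ D))
    (hFD : Set.MapsTo F (U ∩ D) D') (hFp : F p = p')
    (hF : HasFDerivAt (𝕜 := ℝ) F (LinearMap.toContinuousLinearMap L) p) :
    IsGermDifferential D D' p p' L := by
  refine ⟨F, ⟨U, hU, hpU, hFd, hFD, fun Z hZ _ => ?_⟩, fun Z hZ => ?_⟩
  · rw [← hFp]
    exact hF.continuousAt.tendsto.comp hZ.2.1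
  · have := hF.isLittleO.comp_tendsto hZ.2.1
    rw [hFp] at this
    exact this

/-- Read in two different coordinate systems, the identity germ turns the necessary conditions into
information on coordinate changes. -/
theorem isGermDifferential_id : IsGermDifferential D D p p LinearMap.id :=
  IsGermDifferential.of_hasFDerivAt (F := fun Z => Z) isOpen_univ (Set.mem_univ p)
    differentiableOn_id (fun _ hZ => hZ.2) rfl (hasFDerivAt_id p)

/-- The germ is the model map transported by the two coordinate systems. -/
theorem HasBlockForm.isGermDifferential (hφ : IsNormalCoord D p φ) (hφ' : IsNormalCoord D' p' φ')
    (h : HasBlockForm φ φ' p p' L C A lam) (hlam : 0 < lam)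
    (hC : ∀ z, ‖Matrix.toEuclideanLin C z‖ ≤ √lam * ‖z‖) : IsGermDifferential D D' p p' L := by
  set T := LinearMap.toContinuousLinearMap (Matrix.toEuclideanLin C) with hT
  obtain ⟨M, hM, hMD⟩ := hφ.exists_lt_im_of_mem
  obtain ⟨M', hM', hMD'⟩ := hφ'.exists_mem_of_lt_im
  have hmodel := modelMap_mem (T := T) A hlam hC hM.le hM'.le
  have hG0 : Tendsto (modelMap T A lam) (𝓝 0) (𝓝 0) := by
    have := (hasFDerivAt_modelMap T A lam).continuousAt.tendsto
    rwa [modelMap_zero] at this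
  obtain ⟨U, hUs, hU, hpU⟩ := mem_nhds_iff.1 (inter_mem (φ.open_source.mem_nhds hφ.mem_source)
    (inter_mem hMD (inter_mem (hφ.tendsto hmodel) (inter_mem ((hG0.comp hφ.tendsto) hMD')
      ((hG0.comp hφ.tendsto) (φ'.open_target.mem_nhds hφ'.zero_mem_target))))))
  refine IsGermDifferential.of_hasFDerivAt (F := fun Z => φ'.symm (modelMap T A lam (φ Z))) hU hpU
    ?_ ?_ ?_ ?_
  · rintro Z ⟨hZU, hZD⟩
    obtain ⟨h1, h2, h3, -, h5⟩ := hUs hZU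
    exact (DifferentiableAt.comp (g := φ'.symm) Z
      (hφ'.holomorphic_symm.differentiableAt (φ'.open_target.mem_nhds h5))
      (DifferentiableAt.comp (g := modelMap T A lam) Z
        (differentiableAt_modelMap T A lam (h3 (h2 hZD)).1)
        (hφ.holomorphic.differentiableAt
          (φ.open_source.mem_nhds h1)))).differentiableWithinAt
  · rintro Z ⟨hZU, hZD⟩
    obtain ⟨h1, h2, h3, h4, -⟩ := hUs hZU
    exact h4 (h3 (h2 hZD)).2
  · simp only [hφ.map_base, modelMap_zero, hφ'.symm_zero]
  · have d1 := hφ.hasFDerivAt_coe.restrictScalars ℝ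
    have d2 : HasFDerivAt (𝕜 := ℝ) (modelMap T A lam) ((blockMap T A lam).restrictScalars ℝ)
        (φ p) := by rw [hφ.map_base]; exact hasFDerivAt_modelMap T A lam
    have d3 : HasFDerivAt (𝕜 := ℝ) φ'.symm ((hφ'.tangentEquiv.symm :
        CoordSpace n →L[ℂ] AmbientSpace n).restrictScalars ℝ) (modelMap T A lam (φ p)) := by
      rw [hφ.map_base, modelMap_zero]; exact hφ'.hasFDerivAt_symm.restrictScalars ℝ
    refine (d3.comp p (d2.comp p d1)).congr_fderiv ?_
    ext1 v
    have h1 := h v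
    rw [← hφ.tangentEquiv_apply, ← hφ'.tangentEquiv_apply] at h1
    have h2 : blockMap T A lam (hφ.tangentEquiv v) = hφ'.tangentEquiv (L v) := by
      rw [h1, blockMap_apply]; rfl
    change hφ'.tangentEquiv.symm (blockMap T A lam (hφ.tangentEquiv v)) = L v
    rw [h2, ContinuousLinearEquiv.symm_apply_apply]

theorem IsGermDifferential.exists_hasBlockForm (hL : IsGermDifferential D D' p p' L)
    (hD : IsOpen D) (hD' : IsOpen D') (hp : p ∈ frontier D) (hp' : p' ∈ frontier D')
    (hφ : IsNormalCoord D p φ) (hφ' : IsNormalCoord D' p' φ') :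
    ∃ (C : Matrix (Fin n) (Fin n) ℂ) (A : EuclideanSpace ℂ (Fin n)) (lam : ℝ),
      HasBlockForm φ φ' p p' L C A lam ∧ 0 < lam ∧
        ∀ z, ‖Matrix.toEuclideanLin C z‖ ≤ √lam * ‖z‖ := by
  obtain ⟨F, hF, hFL⟩ := hL
  have hg := hF.coordGerm hφ hφ' hD hp hFL
  obtain ⟨C, A, lam, hlam0, hblock⟩ := hg.exists_block hφ hφ'
  have hnormal : (coordDifferential hφ hφ' L (innerNormal n)).2 = lam * Complex.I := by
    rw [hblock]; rfl
  have hlam : 0 < lam := by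
    refine hlam0.lt_of_ne fun h => hg.normal_ne_zero hφ hφ' hD' hp' ?_
    rw [hnormal, ← h]; simp
  refine ⟨C, A, lam, (hasBlockForm_iff hφ hφ' L C A lam).2 hblock, hlam, ?_⟩
  have hunit : ∀ v : EuclideanSpace ℂ (Fin n), ‖v‖ ≤ 1 → ‖Matrix.toEuclideanLin C v‖ ≤ √lam := by
    intro v hv
    have h1 : ∀ k ∈ Set.Ioo (0 : ℝ) 1, k ^ 5 * ‖Matrix.toEuclideanLin C v‖ ^ 2 ≤ lam := by
      intro k hk
      have h2 := hg.mul_sq_norm_le hφ hφ' hD' hp' hv hk.1 hk.2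
      rw [hnormal, hblock] at h2
      simpa using h2
    -- Letting k → 1 removes the loss k⁵.
    have hlim : Tendsto (fun k : ℝ => k ^ 5 * ‖Matrix.toEuclideanLin C v‖ ^ 2) (𝓝[<] 1)
        (𝓝 (1 ^ 5 * ‖Matrix.toEuclideanLin C v‖ ^ 2)) := by
      have : Continuous fun k : ℝ => k ^ 5 * ‖Matrix.toEuclideanLin C v‖ ^ 2 := by fun_prop
      exact (this.tendsto 1).mono_left nhdsWithin_le_nhds
    have h3 := le_of_tendsto hlim (by
      filter_upwards [Ioo_mem_nhdsLT (zero_lt_one' ℝ)] with k hk using h1 k hk)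
    rw [one_pow, one_mul] at h3
    exact Real.le_sqrt_of_sq_le h3
  intro z
  by_cases hz : z = 0
  · simp [hz]
  have hzn : 0 < ‖z‖ := norm_pos_iff.2 hz
  have h4 := hunit ((‖z‖⁻¹ : ℂ) • z) (by
    rw [norm_smul, norm_inv, Complex.norm_real, norm_norm, inv_mul_cancel₀ hzn.ne'])
  rw [map_smul, norm_smul, norm_inv, Complex.norm_real, norm_norm, inv_mul_le_iff₀ hzn] at h4
  linarith

/-- The block form is unique. -/
theorem HasBlockForm.unique (hφ : IsNormalCoord D p φ) {C₁ C₂ : Matrix (Fin n) (Fin n) ℂ}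
    {A₁ A₂ : EuclideanSpace ℂ (Fin n)} {lam₁ lam₂ : ℝ}
    (h₁ : HasBlockForm φ φ' p p' L C₁ A₁ lam₁) (h₂ : HasBlockForm φ φ' p p' L C₂ A₂ lam₂) :
    C₁ = C₂ ∧ lam₁ = lam₂ := by
  have h : ∀ ζ : CoordSpace n,
      ((Matrix.toEuclideanLin C₁ ζ.1 + ζ.2 • A₁, (lam₁ : ℂ) * ζ.2) : CoordSpace n) =
        (Matrix.toEuclideanLin C₂ ζ.1 + ζ.2 • A₂, (lam₂ : ℂ) * ζ.2) := by
    intro ζ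
    have e1 := h₁ (hφ.tangentEquiv.symm ζ)
    have e2 := h₂ (hφ.tangentEquiv.symm ζ)
    rw [e1, ← hφ.tangentEquiv_apply, ContinuousLinearEquiv.apply_symm_apply] at e2
    exact e2
  constructor
  · apply Matrix.toEuclideanLin.injective
    ext1 z
    simpa using congrArg Prod.fst (h (z, 0))
  · have := congrArg Prod.snd (h (0, 1))
    simpa using this

/-- Coordinate changes between normal coordinates are, to first order, multiples of unitary maps
along the complex tangent space. -/
theorem exists_coordChange (hD : IsOpen D) (hp : p ∈ frontier D) (hφ : IsNormalCoord D p φ)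
    (hφ' : IsNormalCoord D p φ') :
    ∃ (U : EuclideanSpace ℂ (Fin n) ≃ₗᵢ[ℂ] EuclideanSpace ℂ (Fin n))
      (A : EuclideanSpace ℂ (Fin n)) (r : ℝ), 0 < r ∧
      ∀ ζ, hφ'.tangentEquiv (hφ.tangentEquiv.symm ζ) =
        ((r : ℂ) • U ζ.1 + ζ.2 • A, (r ^ 2 : ℂ) * ζ.2) := by
  obtain ⟨C₁, A₁, l₁, hb₁, hl₁, hC₁⟩ := (isGermDifferential_id (D := D) (p := p)).exists_hasBlockForm
    hD hD hp hp hφ hφ'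
  obtain ⟨C₂, A₂, l₂, hb₂, hl₂, hC₂⟩ := (isGermDifferential_id (D := D) (p := p)).exists_hasBlockForm
    hD hD hp hp hφ' hφ
  rw [hasBlockForm_iff hφ hφ'] at hb₁
  rw [hasBlockForm_iff hφ' hφ] at hb₂
  simp only [coordDifferential_apply, LinearMap.id_apply] at hb₁ hb₂
  have hcomp : ∀ ζ : CoordSpace n, hφ.tangentEquiv (hφ'.tangentEquiv.symm
      (hφ'.tangentEquiv (hφ.tangentEquiv.symm ζ))) = ζ := fun ζ => by simp
  have hz : ∀ z, Matrix.toEuclideanLin C₂ (Matrix.toEuclideanLin C₁ z) = z := fun z => by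
    have h1 := hcomp (z, 0)
    rw [hb₂, hb₁] at h1
    simpa using congrArg Prod.fst h1
  have hll : l₂ * l₁ = 1 := by
    have h1 := hcomp (0, 1)
    rw [hb₂, hb₁] at h1
    have h2 := congrArg Prod.snd h1
    simp only [mul_one] at h2
    exact_mod_cast h2
  have hss : √l₂ * √l₁ = 1 := by rw [← Real.sqrt_mul hl₂.le, hll, Real.sqrt_one]
  have hs₁ : 0 < √l₁ := Real.sqrt_pos.2 hl₁
  have hs₂ : 0 < √l₂ := Real.sqrt_pos.2 hl₂
  -- The inverse coordinate change satisfies the same bound, and √l₂·√l₁ = 1 forces equality in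
  -- both.
  have hiso : ∀ z, ‖Matrix.toEuclideanLin C₁ z‖ = √l₁ * ‖z‖ := by
    intro z
    refine le_antisymm (hC₁ z) ?_
    have h1 := hC₂ (Matrix.toEuclideanLin C₁ z)
    rw [hz] at h1
    calc √l₁ * ‖z‖ ≤ √l₁ * (√l₂ * ‖Matrix.toEuclideanLin C₁ z‖) := by gcongr
      _ = (√l₂ * √l₁) * ‖Matrix.toEuclideanLin C₁ z‖ := by ring
      _ = _ := by rw [hss, one_mul]
  let U₀ : EuclideanSpace ℂ (Fin n) →ₗᵢ[ℂ] EuclideanSpace ℂ (Fin n) :=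
    { toLinearMap := ((√l₁)⁻¹ : ℂ) • Matrix.toEuclideanLin C₁
      norm_map' := fun z => by
        rw [LinearMap.smul_apply, norm_smul, hiso, norm_inv, Complex.norm_real, Real.norm_eq_abs,
          abs_of_pos hs₁, inv_mul_cancel_left₀ hs₁.ne'] }
  refine ⟨U₀.toLinearIsometryEquiv rfl, A₁, √l₁, hs₁, fun ζ => ?_⟩
  rw [hb₁]
  have hc : ((√l₁ : ℝ) : ℂ) ≠ 0 := by exact_mod_cast hs₁.ne'
  refine Prod.ext ?_ ?_
  · have : U₀ ζ.1 = ((√l₁)⁻¹ : ℂ) • Matrix.toEuclideanLin C₁ ζ.1 := rfl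
    simp only [LinearIsometry.coe_toLinearIsometryEquiv]
    rw [this, smul_smul, mul_inv_cancel₀ hc, one_smul]
  · simp only
    rw [← Complex.ofReal_pow, Real.sq_sqrt hl₁.le]

/-- The coordinate changes multiply C by r'r and by unitary maps on both sides, and λ by (r'r)²; the
factor r'r cancels in the ratio. -/
theorem matrixSingularValue_div_sqrt_eq (hD : IsOpen D) (hD' : IsOpen D') (hp : p ∈ frontier D)
    (hp' : p' ∈ frontier D') (hL : IsGermDifferential D D' p p' L)
    {φ₁ φ₁' φ₂ φ₂' : OpenPartialHomeomorph (AmbientSpace n) (CoordSpace n)}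
    (h₁ : IsNormalCoord D p φ₁) (h₁' : IsNormalCoord D' p' φ₁')
    (h₂ : IsNormalCoord D p φ₂) (h₂' : IsNormalCoord D' p' φ₂')
    {C₁ C₂ : Matrix (Fin n) (Fin n) ℂ} {A₁ A₂ : EuclideanSpace ℂ (Fin n)} {lam₁ lam₂ : ℝ}
    (hb₁ : HasBlockForm φ₁ φ₁' p p' L C₁ A₁ lam₁) (hb₂ : HasBlockForm φ₂ φ₂' p p' L C₂ A₂ lam₂)
    (j : Fin n) :
    matrixSingularValue C₁ j / √lam₁ = matrixSingularValue C₂ j / √lam₂ := by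
  have hlam₁ : 0 < lam₁ := by
    obtain ⟨C, A, lam, hb, hlam, -⟩ := hL.exists_hasBlockForm hD hD' hp hp' h₁ h₁'
    rwa [(hb₁.unique h₁ hb).2]
  obtain ⟨U, A, r, hr, hU⟩ := exists_coordChange hD hp h₂ h₁
  obtain ⟨V, A', r', hr', hV⟩ := exists_coordChange hD' hp' h₁' h₂'
  rw [hasBlockForm_iff h₁ h₁'] at hb₁
  rw [hasBlockForm_iff h₂ h₂'] at hb₂
  have hcomp : ∀ ζ : CoordSpace n, coordDifferential h₂ h₂' L ζ =
      h₂'.tangentEquiv (h₁'.tangentEquiv.symm (coordDifferential h₁ h₁' L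
        (h₁.tangentEquiv (h₂.tangentEquiv.symm ζ)))) := fun ζ => by
    simp [coordDifferential_apply]
  have hC : ∀ z, Matrix.toEuclideanLin C₂ z =
      ((r' * r : ℝ) : ℂ) • V (Matrix.toEuclideanLin C₁ (U z)) := by
    intro z
    have e := hcomp (z, 0)
    rw [hb₂, hU, hb₁, hV] at e
    have e2 := congrArg Prod.fst e
    simp only [zero_smul, add_zero, mul_zero, map_smul, smul_smul] at e2
    rw [e2, Complex.ofReal_mul]
  have hlam : lam₂ = (r' * r) ^ 2 * lam₁ := by
    have e := hcomp (0, 1)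
    rw [hb₂, hU, hb₁, hV] at e
    have e2 := congrArg Prod.snd e
    simp only [mul_one] at e2
    have e3 : lam₂ = r' ^ 2 * (lam₁ * r ^ 2) := by exact_mod_cast e2
    rw [e3]; ring
  have hrr : 0 < r' * r := mul_pos hr' hr
  have hσ : matrixSingularValue C₂ j = (r' * r) * matrixSingularValue C₁ j :=
    LinearMap.singularValues_smul_conj _ _ U V hrr.le hC j
  rw [hσ, hlam, Real.sqrt_mul (sq_nonneg _), Real.sqrt_sq hrr.le,
    mul_div_mul_left _ _ hrr.ne']

end main

theorem proposition1p1 (n : ℕ) (D D' : Set (AmbientSpace n))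
    (hDo : IsOpen D) (hDc : IsConnected D) (hDo' : IsOpen D') (hDc' : IsConnected D')
    (p p' : AmbientSpace n) (hp : p ∈ frontier D) (hp' : p' ∈ frontier D') :
    -- the characterization, in any coordinates in normal form
    (∀ φ φ' : OpenPartialHomeomorph (AmbientSpace n) (CoordSpace n),
      IsNormalCoord D p φ → IsNormalCoord D' p' φ' →
      ∀ L : AmbientSpace n →ₗ[ℝ] AmbientSpace n,
        IsGermDifferential D D' p p' L ↔
          ∃ (C : Matrix (Fin n) (Fin n) ℂ) (A : EuclideanSpace ℂ (Fin n)) (lam : ℝ),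
            HasBlockForm φ φ' p p' L C A lam ∧ 0 < lam ∧
              ∀ j : Fin n, matrixSingularValue C j ≤ √lam) ∧
    -- the ratios do not depend on the coordinates
    (∀ L : AmbientSpace n →ₗ[ℝ] AmbientSpace n, IsGermDifferential D D' p p' L →
      ∀ φ₁ φ₁' φ₂ φ₂' : OpenPartialHomeomorph (AmbientSpace n) (CoordSpace n),
        IsNormalCoord D p φ₁ → IsNormalCoord D' p' φ₁' →
        IsNormalCoord D p φ₂ → IsNormalCoord D' p' φ₂' →
        ∀ (C₁ C₂ : Matrix (Fin n) (Fin n) ℂ) (A₁ A₂ : EuclideanSpace ℂ (Fin n)) (lam₁ lam₂ : ℝ),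
          HasBlockForm φ₁ φ₁' p p' L C₁ A₁ lam₁ → HasBlockForm φ₂ φ₂' p p' L C₂ A₂ lam₂ →
          ∀ j : Fin n,
            matrixSingularValue C₁ j / √lam₁ = matrixSingularValue C₂ j / √lam₂) := by
  refine ⟨fun φ φ' hφ hφ' L => ⟨fun hL => ?_, ?_⟩, ?_⟩
  · obtain ⟨C, A, lam, hb, hlam, hC⟩ := hL.exists_hasBlockForm hDo hDo' hp hp' hφ hφ'
    exact ⟨C, A, lam, hb, hlam,
      (forall_matrixSingularValue_le_iff C (Real.sqrt_nonneg lam)).2 hC⟩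
  · rintro ⟨C, A, lam, hb, hlam, hC⟩
    exact hb.isGermDifferential hφ hφ' hlam
      ((forall_matrixSingularValue_le_iff C (Real.sqrt_nonneg lam)).1 hC)
  · intro L hL φ₁ φ₁' φ₂ φ₂' h₁ h₁' h₂ h₂' C₁ C₂ A₁ A₂ lam₁ lam₂ hb₁ hb₂ j
    exact matrixSingularValue_div_sqrt_eq hDo hDo' hp hp' hL h₁ h₁' h₂ h₂' hb₁ hb₂ j
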